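/- Let $\Bbbk$ be a field (for instance $\Bbbk=\mathbb C$), let $q\in\Bbbk$ be non-zero and let $q^{1/2}\in\Bbbk$ be a square root of $q$. **Notions.** Let $H$ be a bialgebra over $\Bbbk$ with multiplication $m$, unit map $u$, counit $\varepsilon$, flip $\tau$ and convolution product $*$. For linear $f:H\otimes H\to\Bbbk$ put $f_{12}=f\otimes\varepsilon$, $f_{23}=\varepsilon\otimes f$, $f_{13}=(\varepsilon\otimes f)(\tau\otimes\mathrm{Id})$ and $f^{\mathrm{op}}=f\tau$. A *universal $\mathcal R$-form* is a convolution invertible linear map $\mathcal R:H\otimes H\to\Bbbk$ with $(u\mathcal R)*m=m\tau*(u\mathcal R)$, $\mathcal R(\mathrm{Id}\otimes m)=\mathcal R_{13}*\mathcal R_{12}$ and $\mathcal R(m\otimes\mathrm{Id})=\mathcal R_{13}*\mathcal R_{23}$. Given such an $\mathcal R$, an *infinitesimal $\mathcal R$-form* is a linear map $\chi:H\otimes H\to\Bbbk$ with $$(u\chi)*m=m*(u\chi),\quad \chi(\mathrm{Id}\otimes m)=\chi_{12}+\mathcal R_{12}^{-1}*\chi_{13}*\mathcal R_{12},\quad \chi(m\otimes\mathrm{Id})=\chi_{23}+\mathcal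 R_{23}^{-1}*\chi_{13}*\mathcal R_{23}.$$ The triple $(H,\mathcal R,\chi)$ is then called *pre-Cartier*, and *Cartier* if moreover $\mathcal R*\chi=\chi^{\mathrm{op}}*\mathcal R$. A derivation $D:A\to\Bbbk$ on an algebra $A$ with character $\varepsilon$ is a linear map with $D(xy)=D(x)\varepsilon(y)+\varepsilon(x)D(y)$. **The bialgebras.** $\mathrm M_q(2)$ is the algebra generated by $\alpha,\beta,\gamma,\delta$ with relations $\beta\alpha=q\alpha\beta$, $\gamma\alpha=q\alpha\gamma$, $\delta\beta=q\beta\delta$, $\delta\gamma=q\gamma\delta$, $\gamma\beta=\beta\gamma$, $\alpha\delta-\delta\alpha=(q^{-1}-q)\beta\gamma$, with matrix comultiplication and with counit sending $\begin{pmatrix}\alpha&\beta\\\gamma&\delta\end{pmatrix}$ to the identity matrix. It is graded by word length $|\cdot|$, and $\partial_q=(\partial\otimes\varepsilon)\rho:\mathrm M_q(2)\to\Bbbk$, where $\rho:\mathrm M_q(2)\to\Bbbk[X]\otimes\mathrm M_q(2)$ is the algebra map $\xi\mapsto X^{|\xi|}\otimes\xi$ ($\xi$ homogeneous) and $\partial:\Bbbk[X]\to\Bbbk$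 is linear with $\partial(X^n)=n$. With $\det_q=\alpha\delta-q^{-1}\beta\gamma$, put $\mathrm{GL}_q(2)=\mathrm M_q(2)[\theta]/(\theta\det_q-1)$, where $\theta$ is a central variable; it is a bialgebra with structure extending that of $\mathrm M_q(2)$ and $\theta$ grouplike. **Statement.** 1. There is a unique universal $\mathcal R$-form $\mathcal R$ on $\mathrm M_q(2)$ with $\mathcal R(\alpha\otimes\alpha)=\mathcal R(\delta\otimes\delta)=q^{-1/2}q$, $\mathcal R(\alpha\otimes\delta)=\mathcal R(\delta\otimes\alpha)=q^{-1/2}$, $\mathcal R(\beta\otimes\gamma)=q^{-1/2}(q-q^{-1})$, and value $0$ on the other eleven pairs of generators. The form $\chi=\partial_q\otimes\partial_q$ is a non-zero infinitesimal $\mathcal R$-form on $\mathrm M_q(2)$, the triple $(\mathrm M_q(2),\mathcal R,\chi)$ is Cartier, and $\chi(\xi\otimes\eta)=|\xi|\,|\eta|\,\varepsilon(\xi\eta)$ for all homogeneous $\xi,\eta$. 2. There is a unique universal $\mathcal R$-form on $\mathrm{GL}_q(2)$, again denoted $\mathcal R$, whose pullback along $\mathrm M_q(2)\to\mathrm{GL}_q(2)$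 is the form of part 1. There is a unique derivation $\hat\partial_q:\mathrm M_q(2)[\theta]\to\Bbbk$ (with respect to the counit extended by $\theta\mapsto1$) that restricts to $\partial_q$ on $\mathrm M_q(2)$ and maps $\theta$ to $-2$; it descends to a derivation $\hat\partial_q:\mathrm{GL}_q(2)\to\Bbbk$. The form $\chi=\hat\partial_q\otimes\hat\partial_q$ is a non-zero infinitesimal $\mathcal R$-form on $\mathrm{GL}_q(2)$, and $(\mathrm{GL}_q(2),\mathcal R,\chi)$ is Cartier. -/

import Mathlib

open scoped TensorProduct
open Coalgebra WithConv

noncomputable section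

section Coquasitriangular

variable {𝕜 H : Type*} [Field 𝕜] [Ring H] [Bialgebra 𝕜 H]

/-- Convolution invertible linear maps `H ⊗ H → 𝕜`. -/
abbrev ConvUnits (𝕜 H : Type*) [Field 𝕜] [Ring H] [Bialgebra 𝕜 H] :=
  (WithConv (H ⊗[𝕜] H →ₗ[𝕜] 𝕜))ˣ

/-- The form `f ⊗ g : H ⊗ H → 𝕜`, `a ⊗ b ↦ f a * g b`. -/
def tensorForm (f g : H →ₗ[𝕜] 𝕜) : H ⊗[𝕜] H →ₗ[𝕜] 𝕜 :=
  (TensorProduct.lid 𝕜 𝕜).toLinearMap ∘ₗ TensorProduct.map f g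

/-- `f₁₂ = f ⊗ ε`, as an element of the convolution algebra on `H ⊗ H ⊗ H`. -/
def leg12 (f : H ⊗[𝕜] H →ₗ[𝕜] 𝕜) : WithConv (H ⊗[𝕜] (H ⊗[𝕜] H) →ₗ[𝕜] 𝕜) :=
  toConv ((TensorProduct.lid 𝕜 𝕜).toLinearMap ∘ₗ
    TensorProduct.map f (counit (R := 𝕜) (A := H)) ∘ₗ
      (TensorProduct.assoc 𝕜 H H H).symm.toLinearMap)

/-- `f₂₃ = ε ⊗ f`. -/
def leg23 (f : H ⊗[𝕜] H →ₗ[𝕜] 𝕜) : WithConv (H ⊗[𝕜] (H ⊗[𝕜] H) →ₗ[𝕜] 𝕜) :=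
  toConv ((TensorProduct.lid 𝕜 𝕜).toLinearMap ∘ₗ
    TensorProduct.map (counit (R := 𝕜) (A := H)) f)

/-- `f₁₃ = (ε ⊗ f) (τ ⊗ Id)`. -/
def leg13 (f : H ⊗[𝕜] H →ₗ[𝕜] 𝕜) : WithConv (H ⊗[𝕜] (H ⊗[𝕜] H) →ₗ[𝕜] 𝕜) :=
  toConv ((leg23 f).ofConv ∘ₗ (TensorProduct.assoc 𝕜 H H H).toLinearMap ∘ₗ
    TensorProduct.map (TensorProduct.comm 𝕜 H H).toLinearMap LinearMap.id ∘ₗ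
      (TensorProduct.assoc 𝕜 H H H).symm.toLinearMap)

/-- `u_H f`, i.e. `f` followed by the unit map `𝕜 → H`. -/
def unitComp (f : H ⊗[𝕜] H →ₗ[𝕜] 𝕜) : WithConv (H ⊗[𝕜] H →ₗ[𝕜] H) :=
  toConv (Algebra.linearMap 𝕜 H ∘ₗ f)

/-- `f (Id ⊗ m)`, i.e. `a ⊗ b ⊗ c ↦ f (a ⊗ b c)`. -/
def formMulRight (f : H ⊗[𝕜] H →ₗ[𝕜] 𝕜) : WithConv (H ⊗[𝕜] (H ⊗[𝕜] H) →ₗ[𝕜] 𝕜) :=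
  toConv (f ∘ₗ TensorProduct.map LinearMap.id (LinearMap.mul' 𝕜 H))

/-- `f (m ⊗ Id)`, i.e. `a ⊗ b ⊗ c ↦ f (a b ⊗ c)`. -/
def formMulLeft (f : H ⊗[𝕜] H →ₗ[𝕜] 𝕜) : WithConv (H ⊗[𝕜] (H ⊗[𝕜] H) →ₗ[𝕜] 𝕜) :=
  toConv (f ∘ₗ TensorProduct.map (LinearMap.mul' 𝕜 H) LinearMap.id ∘ₗ
    (TensorProduct.assoc 𝕜 H H H).symm.toLinearMap)

/-- `R` is a universal R-form: `R * m = mᵒᵖ * R`, `R (Id ⊗ m) = R₁₃ * R₁₂` and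
`R (m ⊗ Id) = R₁₃ * R₂₃`, all products being convolution products. -/
structure IsCoquasitriangular (R : ConvUnits 𝕜 H) : Prop where
  mul_comm : unitComp R.val.ofConv * toConv (LinearMap.mul' 𝕜 H) =
    toConv (LinearMap.mul' 𝕜 H ∘ₗ (TensorProduct.comm 𝕜 H H).toLinearMap) *
      unitComp R.val.ofConv
  mul_right : formMulRight R.val.ofConv = leg13 R.val.ofConv * leg12 R.val.ofConv
  mul_left : formMulLeft R.val.ofConv = leg13 R.val.ofConv * leg23 R.val.ofConv

/-- `χ` is an infinitesimal R-form: `(u χ) * m = m * (u χ)`,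
`χ (Id ⊗ m) = χ₁₂ + R₁₂⁻¹ * χ₁₃ * R₁₂` and `χ (m ⊗ Id) = χ₂₃ + R₂₃⁻¹ * χ₁₃ * R₂₃`. -/
structure IsInfinitesimalRForm (R : ConvUnits 𝕜 H) (χ : H ⊗[𝕜] H →ₗ[𝕜] 𝕜) : Prop where
  mul_comm : unitComp χ * toConv (LinearMap.mul' 𝕜 H) =
    toConv (LinearMap.mul' 𝕜 H) * unitComp χ
  mul_right : formMulRight χ = leg12 χ + leg12 R⁻¹.val.ofConv * leg13 χ * leg12 R.val.ofConv
  mul_left : formMulLeft χ = leg23 χ + leg23 R⁻¹.val.ofConv * leg13 χ * leg23 R.val.ofConv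

/-- `(H, R, χ)` is a pre-Cartier coquasitriangular bialgebra. -/
structure IsPreCartier (R : ConvUnits 𝕜 H) (χ : H ⊗[𝕜] H →ₗ[𝕜] 𝕜) : Prop where
  coquasitriangular : IsCoquasitriangular R
  infinitesimalRForm : IsInfinitesimalRForm R χ

/-- `(H, R, χ)` is Cartier: it is pre-Cartier and `R * χ = χᵒᵖ * R`. -/
structure IsCartier (R : ConvUnits 𝕜 H) (χ : H ⊗[𝕜] H →ₗ[𝕜] 𝕜) : Prop
    extends IsPreCartier R χ where
  cartier : R.val * toConv χ =
    toConv (χ ∘ₗ (TensorProduct.comm 𝕜 H H).toLinearMap) * R.val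

end Coquasitriangular

/-- `D : A → 𝕜` is a derivation, where `𝕜` is an `A`-bimodule through the character `e`. -/
def IsPointDerivation {𝕜 A : Type*} [Field 𝕜] [Ring A] [Algebra 𝕜 A]
    (e : A →ₐ[𝕜] 𝕜) (D : A →ₗ[𝕜] 𝕜) : Prop :=
  ∀ x y : A, D (x * y) = D x * e y + e x * D y

section Mq

variable {𝕜 : Type*} [Field 𝕜] (q : 𝕜ˣ)

/-- The Manin relations on the free algebra on the entries `(i, j)` of a 2 × 2 matrix. -/
inductive ManinRel : FreeAlgebra 𝕜 (Fin 2 × Fin 2) → FreeAlgebra 𝕜 (Fin 2 × Fin 2) → Prop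
  | ba : ManinRel (.ι 𝕜 (0, 1) * .ι 𝕜 (0, 0)) ((q : 𝕜) • (.ι 𝕜 (0, 0) * .ι 𝕜 (0, 1)))
  | ca : ManinRel (.ι 𝕜 (1, 0) * .ι 𝕜 (0, 0)) ((q : 𝕜) • (.ι 𝕜 (0, 0) * .ι 𝕜 (1, 0)))
  | db : ManinRel (.ι 𝕜 (1, 1) * .ι 𝕜 (0, 1)) ((q : 𝕜) • (.ι 𝕜 (0, 1) * .ι 𝕜 (1, 1)))
  | dc : ManinRel (.ι 𝕜 (1, 1) * .ι 𝕜 (1, 0)) ((q : 𝕜) • (.ι 𝕜 (1, 0) * .ι 𝕜 (1, 1)))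
  | cb : ManinRel (.ι 𝕜 (1, 0) * .ι 𝕜 (0, 1)) (.ι 𝕜 (0, 1) * .ι 𝕜 (1, 0))
  | ad : ManinRel (.ι 𝕜 (0, 0) * .ι 𝕜 (1, 1) - .ι 𝕜 (1, 1) * .ι 𝕜 (0, 0))
      (((q : 𝕜)⁻¹ - q) • (.ι 𝕜 (0, 1) * .ι 𝕜 (1, 0)))

/-- The quantum matrix algebra `M_q(2)`. -/
def Mq : Type _ := RingQuot (ManinRel q)

instance : Ring (Mq q) := inferInstanceAs (Ring (RingQuot (ManinRel q)))
instance : Algebra 𝕜 (Mq q) := inferInstanceAs (Algebra 𝕜 (RingQuot (ManinRel q)))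

namespace Mq

def mk : FreeAlgebra 𝕜 (Fin 2 × Fin 2) →ₐ[𝕜] Mq q := RingQuot.mkAlgHom 𝕜 (ManinRel q)

/-- The generators of `M_q(2)`, arranged as the matrix with rows `α, β` and `γ, δ`. -/
def T (i j : Fin 2) : Mq q := mk q (.ι 𝕜 (i, j))

abbrev α : Mq q := T q 0 0
abbrev β : Mq q := T q 0 1
abbrev γ : Mq q := T q 1 0
abbrev δ : Mq q := T q 1 1

theorem mk_rel {x y : FreeAlgebra 𝕜 (Fin 2 × Fin 2)} (h : ManinRel q x y) :
    mk q x = mk q y :=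
  RingQuot.mkAlgHom_rel 𝕜 h

theorem ba : β q * α q = (q : 𝕜) • (α q * β q) := by
  simpa [T] using mk_rel q .ba

theorem ca : γ q * α q = (q : 𝕜) • (α q * γ q) := by
  simpa [T] using mk_rel q .ca

theorem db : δ q * β q = (q : 𝕜) • (β q * δ q) := by
  simpa [T] using mk_rel q .db

theorem dc : δ q * γ q = (q : 𝕜) • (γ q * δ q) := by
  simpa [T] using mk_rel q .dc

theorem cb : γ q * β q = β q * γ q := by
  simpa [T] using mk_rel q .cb

theorem ad : α q * δ q - δ q * α q = ((q : 𝕜)⁻¹ - q) • (β q * γ q) := by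
  simpa [T] using mk_rel q .ad

theorem da : δ q * α q = α q * δ q - ((q : 𝕜)⁻¹ - q) • (β q * γ q) := by
  rw [← ad]; abel

variable {B : Type*} [Ring B] [Algebra 𝕜 B]

/-- The algebra map out of `M_q(2)` given by four elements subject to the Manin relations. -/
def lift (t : Fin 2 → Fin 2 → B)
    (h : ∀ x y, ManinRel q x y →
      FreeAlgebra.lift 𝕜 (fun p : Fin 2 × Fin 2 ↦ t p.1 p.2) x =
        FreeAlgebra.lift 𝕜 (fun p : Fin 2 × Fin 2 ↦ t p.1 p.2) y) : Mq q →ₐ[𝕜] B :=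
  RingQuot.liftAlgHom 𝕜 ⟨FreeAlgebra.lift 𝕜 fun p : Fin 2 × Fin 2 ↦ t p.1 p.2, h⟩

theorem lift_T (t : Fin 2 → Fin 2 → B) (h) (i j : Fin 2) : lift q t h (T q i j) = t i j := by
  unfold lift T mk
  refine (RingQuot.liftAlgHom_mkAlgHom_apply _ _ _ _).trans ?_
  simp

theorem algHom_ext {f g : Mq q →ₐ[𝕜] B} (h : ∀ i j, f (T q i j) = g (T q i j)) : f = g := by
  refine RingQuot.ringQuot_ext' 𝕜 f g (FreeAlgebra.hom_ext ?_)
  funext p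
  exact h p.1 p.2

/-- Matrix comultiplication. -/
def comulHom : Mq q →ₐ[𝕜] Mq q ⊗[𝕜] Mq q :=
  lift q (fun i j ↦ ∑ k, T q i k ⊗ₜ[𝕜] T q k j) (by
    have hq : (q : 𝕜) ≠ 0 := q.ne_zero
    intro x y h
    cases h <;>
    simp only [map_mul, map_smul, map_sub, FreeAlgebra.lift_ι_apply, Fin.sum_univ_two, add_mul,
      mul_add, Algebra.TensorProduct.tmul_mul_tmul, ba, ca, db, dc, cb, da,
      ← TensorProduct.smul_tmul', TensorProduct.tmul_smul, TensorProduct.sub_tmul,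
      TensorProduct.tmul_sub, smul_add, smul_sub, smul_smul] <;>
    match_scalars <;> (try field_simp) <;> ring)

/-- The counit, sending the matrix of generators to the identity matrix. -/
def counitHom : Mq q →ₐ[𝕜] 𝕜 :=
  lift q (fun i j ↦ if i = j then 1 else 0) (by
    intro x y h
    cases h <;> simp)

instance : Bialgebra 𝕜 (Mq q) :=
  Bialgebra.ofAlgHom (comulHom q) (counitHom q)
    (algHom_ext q fun i j ↦ by
      simp [comulHom, lift_T, TensorProduct.tmul_add, TensorProduct.add_tmul]
      abel)
    (algHom_ext q fun i j ↦ by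
      fin_cases i <;> fin_cases j <;> simp [comulHom, counitHom, lift_T])
    (algHom_ext q fun i j ↦ by
      fin_cases i <;> fin_cases j <;> simp [comulHom, counitHom, lift_T])

theorem comul_T (i j : Fin 2) :
    comul (R := 𝕜) (T q i j) = ∑ k, T q i k ⊗ₜ[𝕜] T q k j :=
  lift_T q _ _ i j

theorem counit_T (i j : Fin 2) : counit (R := 𝕜) (T q i j) = if i = j then 1 else 0 :=
  lift_T q _ _ i j

/-- The coaction of `𝕜[X]` (with `X` grouplike) that encodes the grading by length:
the algebra map `ξ ↦ X ^ |ξ| ⊗ ξ`. -/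
def degCoaction : Mq q →ₐ[𝕜] Polynomial 𝕜 ⊗[𝕜] Mq q :=
  lift q (fun i j ↦ Polynomial.X ⊗ₜ[𝕜] T q i j) (by
    intro x y h
    cases h <;>
    simp only [map_mul, map_smul, map_sub, FreeAlgebra.lift_ι_apply,
      Algebra.TensorProduct.tmul_mul_tmul, ba, ca, db, dc, cb, da,
      TensorProduct.tmul_smul, TensorProduct.tmul_sub]
    abel)

/-- The derivation `∂ : 𝕜[X] → 𝕜` with `∂ (X ^ n) = n`, i.e. `p ↦ p'(1)`. -/
def polyDer (𝕜 : Type*) [Field 𝕜] : Polynomial 𝕜 →ₗ[𝕜] 𝕜 :=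
  Polynomial.leval 1 ∘ₗ Polynomial.derivative

/-- The derivation `∂_q`, `ξ ↦ ∂ (ξ₋₁) ε (ξ₀)`. -/
def der : Mq q →ₗ[𝕜] 𝕜 :=
  (TensorProduct.lid 𝕜 𝕜).toLinearMap ∘ₗ
    TensorProduct.map (polyDer 𝕜) (counit (R := 𝕜) (A := Mq q)) ∘ₗ
      (degCoaction q).toLinearMap

/-- The homogeneous elements of degree `n`: the span of the products of `n` generators. -/
def homogeneous (n : ℕ) : Submodule 𝕜 (Mq q) :=
  (Submodule.span 𝕜 {α q, β q, γ q, δ q}) ^ n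

/-- The quantum determinant. -/
def det : Mq q := α q * δ q - (q : 𝕜)⁻¹ • (β q * γ q)

theorem comul_det : comul (R := 𝕜) (det q) = det q ⊗ₜ[𝕜] det q := by
  have hq : (q : 𝕜) ≠ 0 := q.ne_zero
  simp only [det, map_sub, map_smul, Bialgebra.comul_mul, comul_T, Fin.sum_univ_two, add_mul,
      mul_add, Algebra.TensorProduct.tmul_mul_tmul, ba, dc, cb, da,
      ← TensorProduct.smul_tmul', TensorProduct.tmul_smul, TensorProduct.sub_tmul,
      TensorProduct.tmul_sub, smul_add, smul_sub, smul_smul]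
  match_scalars <;> (try field_simp) <;> ring

theorem counit_det : counit (R := 𝕜) (det q) = 1 := by
  simp [det, counit_T]

/-- The values of the standard R-form on the generators; `s` is a square root of `q`. -/
def HasStandardValues (s : 𝕜ˣ) (R : Mq q ⊗[𝕜] Mq q →ₗ[𝕜] 𝕜) : Prop :=
  !![R (α q ⊗ₜ α q), R (β q ⊗ₜ β q), R (α q ⊗ₜ β q), R (β q ⊗ₜ α q);
     R (γ q ⊗ₜ γ q), R (δ q ⊗ₜ δ q), R (γ q ⊗ₜ δ q), R (δ q ⊗ₜ γ q);
     R (α q ⊗ₜ γ q), R (β q ⊗ₜ δ q), R (α q ⊗ₜ δ q), R (β q ⊗ₜ γ q);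
     R (γ q ⊗ₜ α q), R (δ q ⊗ₜ β q), R (γ q ⊗ₜ β q), R (δ q ⊗ₜ α q)] =
  (s : 𝕜)⁻¹ •
  !![(q : 𝕜), 0, 0, 0;
     0, (q : 𝕜), 0, 0;
     0, 0, 1, (q : 𝕜) - (q : 𝕜)⁻¹;
     0, 0, 0, 1]

/-- The standard R-form on `M_q(2)`: the universal R-form with the standard values on
generators. -/
structure IsStandardRForm (s : 𝕜ˣ) (R : ConvUnits 𝕜 (Mq q)) : Prop where
  coquasitriangular : IsCoquasitriangular R
  values : HasStandardValues q s R.val.ofConv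

end Mq

/-- The relation `θ det_q = 1` on `M_q(2)[θ]`. -/
inductive GLRel : Polynomial (Mq q) → Polynomial (Mq q) → Prop
  | mk : GLRel (Polynomial.X * Polynomial.C (Mq.det q)) 1

/-- The quantum group `GL_q(2) = M_q(2)[θ] / (θ det_q - 1)`. -/
def GLq : Type _ := RingQuot (GLRel q)

instance : Ring (GLq q) := inferInstanceAs (Ring (RingQuot (GLRel q)))
instance : Algebra 𝕜 (GLq q) := inferInstanceAs (Algebra 𝕜 (RingQuot (GLRel q)))

namespace GLq

/-- The projection `M_q(2)[θ] → GL_q(2)`. -/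
def mk : Polynomial (Mq q) →ₐ[𝕜] GLq q := RingQuot.mkAlgHom 𝕜 (GLRel q)

/-- The canonical map `M_q(2) → GL_q(2)`. -/
def ofMq : Mq q →ₐ[𝕜] GLq q := (mk q).comp Polynomial.CAlgHom

def θ : GLq q := mk q Polynomial.X

theorem θ_mul_det : θ q * ofMq q (Mq.det q) = 1 := by
  have h : mk q (Polynomial.X * Polynomial.C (Mq.det q)) = mk q 1 :=
    RingQuot.mkAlgHom_rel 𝕜 GLRel.mk
  rwa [map_mul, map_one] at h

theorem ofMq_comm (x : Mq q) : Commute (ofMq q x) (θ q) := by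
  have h := congrArg (mk q) (Polynomial.X_mul_C x).symm
  rwa [map_mul, map_mul] at h

variable {B : Type*} [Ring B] [Algebra 𝕜 B]

def lift (f : Mq q →ₐ[𝕜] B) (t : B) (hc : ∀ x, Commute (f x) t) (h : t * f (Mq.det q) = 1) :
    GLq q →ₐ[𝕜] B :=
  RingQuot.liftAlgHom 𝕜 ⟨Polynomial.eval₂AlgHom f t hc, by
    rintro _ _ ⟨⟩
    rw [map_mul, map_one]
    simpa [-map_mul] using h⟩

theorem lift_mk (f : Mq q →ₐ[𝕜] B) (t : B) (hc) (h) (p : Polynomial (Mq q)) :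
    lift q f t hc h (mk q p) = Polynomial.eval₂AlgHom f t hc p :=
  RingQuot.liftAlgHom_mkAlgHom_apply _ _ _ _

theorem lift_ofMq (f : Mq q →ₐ[𝕜] B) (t : B) (hc) (h) (x : Mq q) :
    lift q f t hc h (ofMq q x) = f x := by
  simp [ofMq, lift_mk]

theorem lift_θ (f : Mq q →ₐ[𝕜] B) (t : B) (hc) (h) : lift q f t hc h (θ q) = t := by
  simp [θ, lift_mk]

theorem algHom_ext {f g : GLq q →ₐ[𝕜] B} (h : ∀ i j, f (ofMq q (Mq.T q i j)) =
    g (ofMq q (Mq.T q i j))) (hθ : f (θ q) = g (θ q)) : f = g := by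
  refine RingQuot.ringQuot_ext' 𝕜 f g (Polynomial.algHom_ext' ?_ hθ)
  exact Mq.algHom_ext q h

/-- The comultiplication, extending that of `M_q(2)`, with `θ` grouplike. -/
def comulHom : GLq q →ₐ[𝕜] GLq q ⊗[𝕜] GLq q :=
  lift q ((Algebra.TensorProduct.map (ofMq q) (ofMq q)).comp (Bialgebra.comulAlgHom 𝕜 (Mq q)))
    (θ q ⊗ₜ θ q)
    (fun x ↦ by
      simp only [AlgHom.comp_apply]
      induction Bialgebra.comulAlgHom 𝕜 (Mq q) x using TensorProduct.induction_on with
      | zero => simp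
      | tmul a b =>
        simp [Commute, SemiconjBy, (ofMq_comm q a).eq, (ofMq_comm q b).eq]
      | add a b ha hb => rw [map_add]; exact ha.add_left hb)
    (by simp [Mq.comul_det, θ_mul_det, Algebra.TensorProduct.one_def])

def counitHom : GLq q →ₐ[𝕜] 𝕜 :=
  lift q (Bialgebra.counitAlgHom 𝕜 (Mq q)) 1 (fun _ ↦ Commute.one_right _)
    (by simp [Mq.counit_det])

instance : Bialgebra 𝕜 (GLq q) :=
  Bialgebra.ofAlgHom (comulHom q) (counitHom q)
    (algHom_ext q
      (fun i j ↦ by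
        simp [comulHom, lift_ofMq, Mq.comul_T, TensorProduct.tmul_add, TensorProduct.add_tmul]
        abel)
      (by simp [comulHom, lift_θ]))
    (algHom_ext q
      (fun i j ↦ by
        fin_cases i <;> fin_cases j <;>
          simp [comulHom, counitHom, lift_ofMq, Mq.comul_T, Mq.counit_T])
      (by simp [comulHom, counitHom, lift_θ]))
    (algHom_ext q
      (fun i j ↦ by
        fin_cases i <;> fin_cases j <;>
          simp [comulHom, counitHom, lift_ofMq, Mq.comul_T, Mq.counit_T])
      (by simp [comulHom, counitHom, lift_θ]))

/-- The counit of `M_q(2)[θ]`, with `θ ↦ 1`. -/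
def polyCounit : Polynomial (Mq q) →ₐ[𝕜] 𝕜 :=
  Polynomial.eval₂AlgHom (Bialgebra.counitAlgHom 𝕜 (Mq q)) 1 fun _ ↦ Commute.one_right _

/-- `D` is a derivation on `M_q(2)[θ]` that restricts to `∂_q` and maps `θ` to `-2`. -/
structure IsHatDer (D : Polynomial (Mq q) →ₗ[𝕜] 𝕜) : Prop where
  derivation : IsPointDerivation (polyCounit q) D
  restrict : ∀ ξ : Mq q, D (Polynomial.C ξ) = Mq.der q ξ
  map_θ : D Polynomial.X = -2

/-- The universal R-form on `GL_q(2)` extending the given form `R` on `M_q(2)`. -/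
structure IsExtendedRForm (R : ConvUnits 𝕜 (Mq q)) (S : ConvUnits 𝕜 (GLq q)) : Prop where
  coquasitriangular : IsCoquasitriangular S
  extends_form : ∀ ξ η : Mq q,
    S.val.ofConv (ofMq q ξ ⊗ₜ[𝕜] ofMq q η) = R.val.ofConv (ξ ⊗ₜ[𝕜] η)

end GLq
end Mq
end

/-!
Currying a form on `H ⊗ H` identifies the convolution algebra of `H ⊗ H` with that of the maps
from `H` to the convolution dual of `H`, and turns the axiom for `R (m ⊗ Id)` into multiplicativity
of `a ↦ R (a ⊗ ·)`. So a universal R-form is determined by its values on a matrix of generators.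
Conversely, one column of these values is a representation `r` of the bialgebra. Its matrix
coefficients, in transposed order, are again a `q`-matrix by the Faddeev–Reshetikhin–Takhtajan
relations, and the algebra map from `GL_q(2)` to its convolution dual that they define satisfies
the other axioms because it does so on generators. It is convolution invertible because `GL_q(2)`
is a Hopf algebra, and the R-form of `M_q(2)` is the restriction of that of `GL_q(2)`.

The derivation `∂_q` is the infinitesimal part of a character with values in the dual numbers, which
maps the matrix of generators to the scalar matrix `1 + ε`. Hence `∂_q` is cocentral, and convolving
`∂_q ⊗ ∂_q` with `R` or `m` on the left or on the right gives the same result. For such a form, the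
axioms of an infinitesimal R-form and the Cartier condition reduce to the Leibniz rule.
-/

noncomputable section

/-- The convolution algebra of the linear maps from a coalgebra `C` to an algebra `A`. -/
abbrev ConvAlgebra (R C A : Type*) [CommSemiring R] [AddCommMonoid C] [Module R C] [Semiring A]
    [Algebra R A] :=
  WithConv (C →ₗ[R] A)

namespace ConvAlgebra

section Functoriality

variable {R B C A A' : Type*} [CommSemiring R] [AddCommMonoid B] [Module R B] [Coalgebra R B]
  [AddCommMonoid C] [Module R C] [Coalgebra R C] [Semiring A] [Algebra R A] [Semiring A']
  [Algebra R A']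

variable (A) in
/-- Precomposition with a coalgebra map, as a map of convolution algebras. -/
def precomp (h : B →ₗc[R] C) : ConvAlgebra R C A →ₐ[R] ConvAlgebra R B A :=
  AlgHom.ofLinearMap
    { toFun := fun f ↦ toConv (f.ofConv ∘ₗ h.toLinearMap)
      map_add' := fun _ _ ↦ rfl
      map_smul' := fun _ _ ↦ rfl }
    (by ext; simp)
    fun f g ↦ congrArg toConv (LinearMap.convMul_comp_coalgHom_distrib f g h)

@[simp]
theorem precomp_apply (h : B →ₗc[R] C) (f : ConvAlgebra R C A) (x : B) :
    precomp A h f x = f (h x) := rfl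

variable (C) in
/-- Postcomposition with an algebra map, as a map of convolution algebras. -/
def postcomp (h : A →ₐ[R] A') : ConvAlgebra R C A →ₐ[R] ConvAlgebra R C A' :=
  AlgHom.ofLinearMap
    { toFun := fun f ↦ toConv (h.toLinearMap ∘ₗ f.ofConv)
      map_add' := fun _ _ ↦ by ext; simp
      map_smul' := fun _ _ ↦ by ext; simp }
    (by ext; simp)
    fun f g ↦ congrArg toConv (LinearMap.algHom_comp_convMul_distrib h f g)

@[simp]
theorem postcomp_apply (h : A →ₐ[R] A') (f : ConvAlgebra R C A) (x : C) :
    postcomp C h f x = h (f x) := rfl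

theorem sum_counit_right_smul {ι : Type*} {x : C} (r : Coalgebra.Repr R x ι) :
    ∑ i ∈ r.index, counit (R := R) (r.right i) • r.left i = x := by
  simpa only [map_sum, TensorProduct.rid_tmul, one_smul] using
    congrArg (TensorProduct.rid R C) (Coalgebra.sum_tmul_counit_eq r)

theorem mul_smulRight_counit_apply (f : ConvAlgebra R C A) (a : A) (x : C) :
    (f * toConv ((counit (R := R) (A := C)).smulRight a)) x = f x * a := by
  conv_rhs => rw [← sum_counit_right_smul (ℛ R x)]
  simp [(ℛ R x).convMul_apply, Finset.sum_mul]

theorem smulRight_counit_mul_apply (f : ConvAlgebra R C A) (a : A) (x : C) :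
    (toConv ((counit (R := R) (A := C)).smulRight a) * f) x = a * f x := by
  conv_rhs => rw [← Coalgebra.sum_counit_smul (ℛ R x)]
  simp [(ℛ R x).convMul_apply, Finset.mul_sum]

variable (R C A) in
/-- The inclusion of the constants `x ↦ ε(x) a` into the convolution algebra. -/
def const : A →ₐ[R] ConvAlgebra R C A :=
  AlgHom.ofLinearMap
    { toFun := fun a ↦ toConv ((counit (R := R) (A := C)).smulRight a)
      map_add' := fun _ _ ↦ by ext; simp
      map_smul' := fun c _ ↦ by ext; simp [smul_comm _ c] }
    (by ext; simp [Algebra.algebraMap_eq_smul_one])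
    fun a b ↦ by
      ext x
      exact ((smulRight_counit_mul_apply _ a x).trans (mul_smul_comm _ _ _)).symm

@[simp]
theorem const_apply (a : A) (x : C) : const R C A a x = counit (R := R) x • a := rfl

@[simp]
theorem mul_const_apply (f : ConvAlgebra R C A) (a : A) (x : C) :
    (f * const R C A a) x = f x * a :=
  mul_smulRight_counit_apply f a x

@[simp]
theorem const_mul_apply (f : ConvAlgebra R C A) (a : A) (x : C) :
    (const R C A a * f) x = a * f x :=
  smulRight_counit_mul_apply f a x

theorem commute_postcomp_ofId_const (f : ConvAlgebra R C R) (a : A) :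
    Commute (postcomp C (Algebra.ofId R A) f) (const R C A a) := by
  ext x
  rw [mul_const_apply, const_mul_apply, postcomp_apply, Algebra.ofId_apply, Algebra.commutes]

end Functoriality

section Curry

variable {R A C D : Type*} [CommSemiring R] [Semiring A] [Algebra R A] [AddCommMonoid C]
  [Module R C] [Coalgebra R C] [AddCommMonoid D] [Module R D] [Coalgebra R D]

theorem curry_mul_apply (f g : ConvAlgebra R (C ⊗[R] D) A) (c : C) (d : D) :
    (f * g) (c ⊗ₜ d) = ∑ i ∈ (ℛ R c).index, ∑ j ∈ (ℛ R d).index,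
      f ((ℛ R c).left i ⊗ₜ (ℛ R d).left j) * g ((ℛ R c).right i ⊗ₜ (ℛ R d).right j) := by
  rw [LinearMap.convMul_apply, TensorProduct.comul_tmul]
  conv_lhs => rw [← (ℛ R c).eq, ← (ℛ R d).eq]
  simp only [TensorProduct.sum_tmul, TensorProduct.tmul_sum, map_sum,
    TensorProduct.AlgebraTensorModule.tensorTensorTensorComm_tmul, TensorProduct.map_tmul,
    LinearMap.mul'_apply]
  exact Finset.sum_comm

variable (R A C D) in
/-- Currying: a linear map on `C ⊗ D` is a linear map on `C` with values in the convolution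
algebra of `D`. -/
def curry : ConvAlgebra R (C ⊗[R] D) A ≃ₐ[R] ConvAlgebra R C (ConvAlgebra R D A) :=
  AlgEquiv.ofLinearEquiv
    (congrLinearEquiv (TensorProduct.lift.equiv (.id R) C D A).symm ≪≫ₗ
      congrLinearEquiv (LinearEquiv.congrRight (WithConv.linearEquiv R (D →ₗ[R] A)).symm))
    (by
      ext c d
      change (1 : ConvAlgebra R (C ⊗[R] D) A) (c ⊗ₜ d) = _
      simp [Algebra.algebraMap_eq_smul_one, ← mul_smul, mul_comm])
    fun f g ↦ by
      ext c d
      refine (curry_mul_apply f g c d).trans ?_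
      rw [(ℛ R c).convMul_apply, ofConv_sum, LinearMap.sum_apply]
      exact Finset.sum_congr rfl fun i _ ↦ Eq.symm <| (ℛ R d).convMul_apply
        (toConv (TensorProduct.curry f.ofConv ((ℛ R c).left i)))
        (toConv (TensorProduct.curry g.ofConv ((ℛ R c).right i)))

@[simp]
theorem curry_apply (f : ConvAlgebra R (C ⊗[R] D) A) (c : C) (d : D) :
    curry R A C D f c d = f (c ⊗ₜ d) := rfl

variable (R C D) in
/-- The projection `c ⊗ d ↦ ε(d) c`. -/
def fstProj : C ⊗[R] D →ₗc[R] C :=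
  (Coalgebra.TensorProduct.rid R R C : C ⊗[R] R →ₗc[R] C).comp
    (Coalgebra.TensorProduct.map (.id R C) (Coalgebra.counitCoalgHom R D))

variable (R C D) in
/-- The projection `c ⊗ d ↦ ε(c) d`. -/
def sndProj : C ⊗[R] D →ₗc[R] D :=
  (Coalgebra.TensorProduct.lid R D : R ⊗[R] D →ₗc[R] D).comp
    (Coalgebra.TensorProduct.map (Coalgebra.counitCoalgHom R C) (.id R D))

@[simp]
theorem fstProj_tmul (c : C) (d : D) : fstProj R C D (c ⊗ₜ d) = counit (R := R) d • c := rfl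

@[simp]
theorem sndProj_tmul (c : C) (d : D) : sndProj R C D (c ⊗ₜ d) = counit (R := R) c • d := rfl

theorem curry_precomp_fstProj (f : ConvAlgebra R C A) :
    curry R A C D (precomp A (fstProj R C D) f) = postcomp C (const R D A) f := by
  ext
  simp

theorem curry_precomp_sndProj (f : ConvAlgebra R D A) :
    curry R A C D (precomp A (sndProj R C D) f) = const R C (ConvAlgebra R D A) f := by
  ext
  simp

theorem precomp_sndProj_mul_precomp_fstProj_apply (f : ConvAlgebra R D A) (g : ConvAlgebra R C A)
    (c : C) (d : D) :
    (precomp A (sndProj R C D) f * precomp A (fstProj R C D) g) (c ⊗ₜ d) = f d * g c := by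
  rw [← curry_apply, map_mul, curry_precomp_sndProj, curry_precomp_fstProj, const_mul_apply,
    postcomp_apply, mul_const_apply]

theorem precomp_fstProj_mul_precomp_sndProj_apply (f : ConvAlgebra R C A) (g : ConvAlgebra R D A)
    (c : C) (d : D) :
    (precomp A (fstProj R C D) f * precomp A (sndProj R C D) g) (c ⊗ₜ d) = f c * g d := by
  rw [← curry_apply, map_mul, curry_precomp_sndProj, curry_precomp_fstProj, mul_const_apply,
    postcomp_apply, const_mul_apply]

end Curry

section Bialgebra

variable {R A H : Type*} [CommSemiring R] [Semiring A] [Algebra R A] [Semiring H]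
  [Bialgebra R H]

/-- The convolution product of two algebra maps on a bialgebra with commuting images, which is
again an algebra map. -/
def mulAlgHom (f g : H →ₐ[R] A) (hfg : ∀ a b, Commute (f a) (g b)) : H →ₐ[R] A :=
  (Algebra.TensorProduct.lift f g hfg).comp (Bialgebra.comulAlgHom R H)

theorem mulAlgHom_apply (f g : H →ₐ[R] A) (hfg) (x : H) :
    mulAlgHom f g hfg x = (toConv f.toLinearMap * toConv g.toLinearMap) x := by
  simp only [mulAlgHom, AlgHom.comp_apply, Bialgebra.comulAlgHom_apply,
    (ℛ R x).convMul_apply, ← (ℛ R x).eq, map_sum, Algebra.TensorProduct.lift_tmul]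
  rfl

end Bialgebra

end ConvAlgebra

/-- Elements `t i j` of a coalgebra with the comultiplication and the counit of the matrix
coalgebra. -/
structure IsComatrix (R : Type*) {C n : Type*} [CommSemiring R] [AddCommMonoid C] [Module R C]
    [Coalgebra R C] [Fintype n] [DecidableEq n] (t : n → n → C) : Prop where
  comul_eq (i j : n) : comul (R := R) (t i j) = ∑ k, t i k ⊗ₜ[R] t k j
  counit_eq (i j : n) : counit (R := R) (t i j) = if i = j then 1 else 0

section EvalAtElements

open ConvAlgebra

variable {R C A n : Type*} [CommSemiring R] [AddCommMonoid C] [Module R C] [Coalgebra R C]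
  [Semiring A] [Algebra R A] [Fintype n] [DecidableEq n]

variable (A) in
/-- Evaluation at a grouplike element, as a character of the convolution algebra. -/
def ConvAlgebra.evalGroupLike {x : C} (hx : IsGroupLikeElem R x) : ConvAlgebra R C A →ₐ[R] A :=
  AlgHom.ofLinearMap (LinearMap.applyₗ x ∘ₗ (WithConv.linearEquiv R (C →ₗ[R] A)).toLinearMap)
    (by simp [hx.counit_eq_one])
    fun f g ↦ by simp [LinearMap.convMul_apply, hx.comul_eq_tmul_self]

@[simp]
theorem ConvAlgebra.evalGroupLike_apply {x : C} (hx : IsGroupLikeElem R x)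
    (f : ConvAlgebra R C A) : evalGroupLike A hx f = f x := rfl

theorem IsComatrix.convMul_apply {t : n → n → C} (ht : IsComatrix R t) (f g : ConvAlgebra R C A)
    (i j : n) : (f * g) (t i j) = ∑ k, f (t i k) * g (t k j) := by
  simp [LinearMap.convMul_apply, ht.comul_eq]

variable (A) in
/-- Evaluation at the entries of a comatrix, as a matrix representation of the convolution
algebra. -/
def IsComatrix.eval {t : n → n → C} (ht : IsComatrix R t) :
    ConvAlgebra R C A →ₐ[R] Matrix n n A :=
  AlgHom.ofLinearMap
    { toFun := fun f ↦ Matrix.of fun i j ↦ f (t i j)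
      map_add' := fun _ _ ↦ rfl
      map_smul' := fun _ _ ↦ rfl }
    (by
      ext i j
      change (1 : ConvAlgebra R C A) (t i j) = _
      simp [ht.counit_eq, Matrix.one_apply, apply_ite (algebraMap R A)])
    fun f g ↦ by
      ext i j
      exact ht.convMul_apply f g i j

@[simp]
theorem IsComatrix.eval_apply {t : n → n → C} (ht : IsComatrix R t) (f : ConvAlgebra R C A)
    (i j : n) : ht.eval A f i j = f (t i j) := rfl

theorem IsComatrix.map {D : Type*} [AddCommMonoid D] [Module R D] [Coalgebra R D]
    {t : n → n → C} (ht : IsComatrix R t) (h : C →ₗc[R] D) : IsComatrix R fun i j ↦ h (t i j) where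
  comul_eq i j := by simp [← CoalgHomClass.map_comp_comul_apply, ht.comul_eq]
  counit_eq i j := by simp [ht.counit_eq]

variable {H : Type*} [Semiring H] [Bialgebra R H]

theorem IsComatrix.mulAlgHom_apply {t : n → n → H} (ht : IsComatrix R t) (f g : H →ₐ[R] A) (hfg)
    (i j : n) : mulAlgHom f g hfg (t i j) = ∑ k, f (t i k) * g (t k j) := by
  rw [ConvAlgebra.mulAlgHom_apply, ht.convMul_apply]
  rfl

end EvalAtElements

/-- The set `s` generates the algebra `A` under the algebra operations and the inversion of units:
the only subalgebra that contains `s` and the inverses of all its elements that are units of `A` is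
`A` itself. -/
def GeneratesWithInverses (R : Type*) {A : Type*} [CommSemiring R] [Semiring A] [Algebra R A]
    (s : Set A) : Prop :=
  ∀ S : Subalgebra R A, s ⊆ S → (∀ u : Aˣ, (u : A) ∈ S → (↑u⁻¹ : A) ∈ S) → S = ⊤

namespace GeneratesWithInverses

variable {R A B : Type*} [CommSemiring R] [Semiring A] [Algebra R A] [Semiring B] [Algebra R B]
  {s : Set A}

theorem of_adjoin_eq_top (hs : Algebra.adjoin R s = ⊤) : GeneratesWithInverses R s :=
  fun _ hS _ ↦ top_le_iff.1 (hs ▸ Algebra.adjoin_le hS)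

theorem semiconjBy (hs : GeneratesWithInverses R s) {f g : A →ₐ[R] B} {x : B}
    (h : ∀ a ∈ s, SemiconjBy x (f a) (g a)) (a : A) : SemiconjBy x (f a) (g a) := by
  let S : Subalgebra R A :=
    { carrier := {a | SemiconjBy x (f a) (g a)}
      mul_mem' := fun {a b} ha hb ↦ by
        change SemiconjBy x (f (a * b)) (g (a * b))
        simpa only [map_mul] using SemiconjBy.mul_right ha hb
      add_mem' := fun {a b} ha hb ↦ by
        change SemiconjBy x (f (a + b)) (g (a + b))
        simpa only [map_add] using SemiconjBy.add_right ha hb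
      algebraMap_mem' := fun r ↦ by
        change x * f (algebraMap R A r) = g (algebraMap R A r) * x
        rw [AlgHom.commutes, AlgHom.commutes, Algebra.commutes] }
  have hinv (u : Aˣ) (hu : SemiconjBy x (f u) (g u)) : SemiconjBy x (f ↑u⁻¹) (g ↑u⁻¹) :=
    SemiconjBy.units_inv_right (x := Units.map f.toMonoidHom u) (y := Units.map g.toMonoidHom u) hu
  exact (hs S h hinv).ge (Algebra.mem_top (x := a))

theorem algHom_ext (hs : GeneratesWithInverses R s) {f g : A →ₐ[R] B}
    (h : ∀ a ∈ s, f a = g a) : f = g := by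
  ext a
  simpa [SemiconjBy] using
    hs.semiconjBy (f := f) (g := g) (x := 1) (fun a ha ↦ by simp [SemiconjBy, h a ha]) a

end GeneratesWithInverses

section RForms

open ConvAlgebra

variable {𝕜 H n : Type*} [Field 𝕜] [Ring H] [Bialgebra 𝕜 H]

theorem leg12_eq_precomp (f : H ⊗[𝕜] H →ₗ[𝕜] 𝕜) :
    leg12 f = precomp 𝕜 (Coalgebra.TensorProduct.map (.id 𝕜 H) (fstProj 𝕜 H H)) (toConv f) := by
  ext a b c
  simp [leg12, mul_comm]

theorem leg13_eq_precomp (f : H ⊗[𝕜] H →ₗ[𝕜] 𝕜) :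
    leg13 f = precomp 𝕜 (Coalgebra.TensorProduct.map (.id 𝕜 H) (sndProj 𝕜 H H)) (toConv f) := by
  ext a b c
  simp [leg13, leg23]

theorem leg23_eq_precomp (f : H ⊗[𝕜] H →ₗ[𝕜] 𝕜) :
    leg23 f = precomp 𝕜 (sndProj 𝕜 H (H ⊗[𝕜] H)) (toConv f) := by
  ext a b c
  simp [leg23]

theorem curry_leg12 (f : H ⊗[𝕜] H →ₗ[𝕜] 𝕜) :
    curry 𝕜 𝕜 H (H ⊗[𝕜] H) (leg12 f) =
      postcomp H (precomp 𝕜 (fstProj 𝕜 H H)) (curry 𝕜 𝕜 H H (toConv f)) := by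
  rw [leg12_eq_precomp]
  rfl

theorem curry_leg13 (f : H ⊗[𝕜] H →ₗ[𝕜] 𝕜) :
    curry 𝕜 𝕜 H (H ⊗[𝕜] H) (leg13 f) =
      postcomp H (precomp 𝕜 (sndProj 𝕜 H H)) (curry 𝕜 𝕜 H H (toConv f)) := by
  rw [leg13_eq_precomp]
  rfl

theorem curry_leg23 (f : H ⊗[𝕜] H →ₗ[𝕜] 𝕜) :
    curry 𝕜 𝕜 H (H ⊗[𝕜] H) (leg23 f) = const 𝕜 H (ConvAlgebra 𝕜 (H ⊗[𝕜] H) 𝕜) (toConv f) := by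
  rw [leg23_eq_precomp, curry_precomp_sndProj]

theorem leg13_mul_leg23_apply (f : H ⊗[𝕜] H →ₗ[𝕜] 𝕜) (a b c : H) :
    (leg13 f * leg23 f) (a ⊗ₜ (b ⊗ₜ c)) =
      (curry 𝕜 𝕜 H H (toConv f) a * curry 𝕜 𝕜 H H (toConv f) b) c := by
  rw [← curry_apply, map_mul, curry_leg13, curry_leg23, mul_const_apply, postcomp_apply,
    ← curry_apply, map_mul, curry_precomp_sndProj, const_mul_apply]

theorem IsComatrix.leg13_mul_leg12_apply [Fintype n] [DecidableEq n] {t : n → n → H}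
    (ht : IsComatrix 𝕜 t) (f : H ⊗[𝕜] H →ₗ[𝕜] 𝕜) (i j : n) (b c : H) :
    (leg13 f * leg12 f) (t i j ⊗ₜ (b ⊗ₜ c)) = ∑ k, f (t i k ⊗ₜ c) * f (t k j ⊗ₜ b) := by
  rw [← curry_apply, map_mul, ht.convMul_apply, ofConv_sum, LinearMap.sum_apply]
  refine Finset.sum_congr rfl fun k _ ↦ ?_
  rw [curry_leg12, curry_leg13, postcomp_apply, postcomp_apply,
    precomp_sndProj_mul_precomp_fstProj_apply]
  rfl

namespace IsCoquasitriangular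

variable {R : ConvUnits 𝕜 H} (hR : IsCoquasitriangular R)

include hR

theorem curry_mul (a b : H) :
    curry 𝕜 𝕜 H H R.val (a * b) = curry 𝕜 𝕜 H H R.val a * curry 𝕜 𝕜 H H R.val b := by
  ext c
  rw [← leg13_mul_leg23_apply, ← hR.mul_left]
  rfl

theorem curry_one : curry 𝕜 𝕜 H H R.val 1 = 1 := by
  have hunit : IsUnit (curry 𝕜 𝕜 H H R.val 1) :=
    (R.isUnit.map (curry 𝕜 𝕜 H H)).map (evalGroupLike _ (IsGroupLikeElem.one (R := 𝕜) (A := H)))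
  have hidem : IsIdempotentElem (curry 𝕜 𝕜 H H R.val 1) := by
    rw [IsIdempotentElem, ← hR.curry_mul, mul_one]
  exact (IsIdempotentElem.iff_eq_one_of_isUnit hunit).1 hidem

/-- The algebra map `a ↦ R (a ⊗ ·)` from `H` to its dual algebra, given by a universal R-form. -/
def leftHom : H →ₐ[𝕜] ConvAlgebra 𝕜 H 𝕜 :=
  AlgHom.ofLinearMap (curry 𝕜 𝕜 H H R.val).ofConv hR.curry_one hR.curry_mul

variable [Fintype n] [DecidableEq n] {t : n → n → H} (ht : IsComatrix 𝕜 t)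

include ht

theorem apply_tmul_mul (i j : n) (b c : H) :
    R.val (t i j ⊗ₜ (b * c)) = ∑ k, R.val (t i k ⊗ₜ c) * R.val (t k j ⊗ₜ b) := by
  rw [← ht.leg13_mul_leg12_apply, ← hR.mul_right]
  rfl

theorem apply_tmul_one (i j : n) : R.val (t i j ⊗ₜ 1) = if i = j then 1 else 0 := by
  have hone : IsGroupLikeElem 𝕜 (1 : H) := .one
  let u : Matrix n n 𝕜 := (evalGroupLike 𝕜 hone).mapMatrix (ht.eval _ (curry 𝕜 𝕜 H H R.val))
  have hunit : IsUnit u := ((R.isUnit.map (curry 𝕜 𝕜 H H)).map (ht.eval _)).map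
    (evalGroupLike 𝕜 hone).mapMatrix
  have hidem : IsIdempotentElem u := by
    ext i j
    simpa [u, Matrix.mul_apply] using (hR.apply_tmul_mul ht i j 1 1).symm
  exact (congrFun₂ ((IsIdempotentElem.iff_eq_one_of_isUnit hunit).1 hidem) i j).trans
    Matrix.one_apply

/-- The matrix representation `b ↦ (R (t j i ⊗ b))` given by a universal R-form and a comatrix. -/
def matrixRep : H →ₐ[𝕜] Matrix n n 𝕜 :=
  AlgHom.ofLinearMap
    { toFun := fun b ↦ Matrix.of fun i j ↦ R.val (t j i ⊗ₜ b)
      map_add' := fun _ _ ↦ by ext; simp [TensorProduct.tmul_add]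
      map_smul' := fun _ _ ↦ by ext; simp }
    (by ext i j; simp [hR.apply_tmul_one ht, Matrix.one_apply, eq_comm])
    fun b c ↦ by
      ext i j
      refine (hR.apply_tmul_mul ht j i b c).trans ?_
      exact Finset.sum_congr rfl fun _ _ ↦ _root_.mul_comm _ _

theorem eq_of_comatrix (hgen : GeneratesWithInverses 𝕜 (Set.range (Function.uncurry t)))
    {S : ConvUnits 𝕜 H} (hS : IsCoquasitriangular S)
    (h : ∀ i j k l, R.val (t i j ⊗ₜ t k l) = S.val (t i j ⊗ₜ t k l)) : R = S := by
  have hrep : hR.matrixRep ht = hS.matrixRep ht := hgen.algHom_ext <| by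
    rintro _ ⟨⟨k, l⟩, rfl⟩
    ext i j
    exact h j i k l
  have hleft : hR.leftHom = hS.leftHom := hgen.algHom_ext <| by
    rintro _ ⟨⟨i, j⟩, rfl⟩
    ext b
    exact congrFun₂ (DFunLike.congr_fun hrep b) j i
  ext a b
  exact LinearMap.congr_fun (congrArg ofConv (DFunLike.congr_fun hleft a)) b

end IsCoquasitriangular

end RForms

/-- A linear map `f` on a coalgebra is cocentral if `∑ f x₁ ⊗ x₂ = ∑ f x₂ ⊗ x₁`. -/
def IsCocentral {R C M : Type*} [CommSemiring R] [AddCommMonoid C] [Module R C] [Coalgebra R C]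
    [AddCommMonoid M] [Module R M] (f : C →ₗ[R] M) : Prop :=
  f.rTensor C ∘ₗ comul = (TensorProduct.comm R C M).toLinearMap ∘ₗ f.lTensor C ∘ₗ comul

namespace IsCocentral

open ConvAlgebra

variable {R C D M N A : Type*} [CommSemiring R] [AddCommMonoid C] [Module R C] [Coalgebra R C]
  [AddCommMonoid D] [Module R D] [Coalgebra R D] [AddCommMonoid M] [Module R M]
  [AddCommMonoid N] [Module R N] [Semiring A] [Algebra R A]

theorem comp_left {f : C →ₗ[R] M} (hf : IsCocentral f) (g : M →ₗ[R] N) :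
    IsCocentral (g ∘ₗ f) := by
  have hcomm : (TensorProduct.comm R C N).toLinearMap ∘ₗ g.lTensor C =
      g.rTensor C ∘ₗ (TensorProduct.comm R C M).toLinearMap := by
    ext; simp
  rw [IsCocentral] at hf
  rw [IsCocentral, LinearMap.rTensor_comp, LinearMap.comp_assoc, hf, LinearMap.lTensor_comp,
    ← LinearMap.comp_assoc, ← LinearMap.comp_assoc, ← hcomm, LinearMap.comp_assoc,
    LinearMap.comp_assoc, LinearMap.comp_assoc]

protected theorem counit : IsCocentral (counit (R := R) (A := C)) := by
  ext x
  simp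

protected theorem tensorProductMap {f : C →ₗ[R] M} {g : D →ₗ[R] N} (hf : IsCocentral f)
    (hg : IsCocentral g) : IsCocentral (TensorProduct.map f g) := by
  have hleft : (TensorProduct.map f g).rTensor (C ⊗[R] D) ∘ₗ
        (TensorProduct.tensorTensorTensorComm R C C D D).toLinearMap =
      (TensorProduct.tensorTensorTensorComm R M C N D).toLinearMap ∘ₗ
        TensorProduct.map (f.rTensor C) (g.rTensor D) := by
    ext; simp
  have hright : (TensorProduct.comm R (C ⊗[R] D) (M ⊗[R] N)).toLinearMap ∘ₗ
        (TensorProduct.map f g).lTensor (C ⊗[R] D) ∘ₗ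
          (TensorProduct.tensorTensorTensorComm R C C D D).toLinearMap =
      (TensorProduct.tensorTensorTensorComm R M C N D).toLinearMap ∘ₗ
        TensorProduct.map ((TensorProduct.comm R C M).toLinearMap ∘ₗ f.lTensor C)
          ((TensorProduct.comm R D N).toLinearMap ∘ₗ g.lTensor D) := by
    ext; simp
  ext c d
  have hl := LinearMap.congr_fun hleft (comul c ⊗ₜ comul d)
  have hr := LinearMap.congr_fun hright (comul c ⊗ₜ comul d)
  have hfc := LinearMap.congr_fun hf c
  have hgd := LinearMap.congr_fun hg d
  simp only [LinearMap.comp_apply, TensorProduct.map_tmul] at hl hr hfc hgd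
  rw [hfc, hgd] at hl
  exact hl.trans hr.symm

theorem commute {f : C →ₗ[R] R} (hf : IsCocentral f) (g : ConvAlgebra R C A) :
    Commute (postcomp C (Algebra.ofId R A) (toConv f)) g := by
  let scale : R ⊗[R] C →ₗ[R] A := TensorProduct.lift ((LinearMap.lsmul R A).compl₂ g.ofConv)
  have hleft : LinearMap.mul' R A ∘ₗ
      TensorProduct.map ((Algebra.ofId R A).toLinearMap ∘ₗ f) g.ofConv = scale ∘ₗ f.rTensor C := by
    ext; simp [scale, Algebra.smul_def, Algebra.ofId_apply]
  have hright : LinearMap.mul' R A ∘ₗ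
      TensorProduct.map g.ofConv ((Algebra.ofId R A).toLinearMap ∘ₗ f) =
        scale ∘ₗ (TensorProduct.comm R C R).toLinearMap ∘ₗ f.lTensor C := by
    ext; simp [scale, Algebra.smul_def, Algebra.ofId_apply, Algebra.commutes]
  ext x
  have hl := LinearMap.congr_fun hleft (comul x)
  have hr := LinearMap.congr_fun hright (comul x)
  have hx := LinearMap.congr_fun hf x
  simp only [LinearMap.comp_apply] at hl hr hx
  exact (hl.trans (congrArg scale hx)).trans hr.symm

end IsCocentral

section CocentralAlgHom

open ConvAlgebra

variable {R H A n : Type*} [CommSemiring R] [Semiring H] [Bialgebra R H] [Semiring A] [Algebra R A]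
  [Fintype n] [DecidableEq n]

theorem IsComatrix.isCocentral_of_eq_ite {t : n → n → H} (ht : IsComatrix R t)
    (hgen : GeneratesWithInverses R (Set.range (Function.uncurry t))) (φ : H →ₐ[R] A) (a : A)
    (hφ : ∀ i j, φ (t i j) = if i = j then a else 0) : IsCocentral φ.toLinearMap := by
  let ψ : H →ₐ[R] A ⊗[R] H := Algebra.TensorProduct.includeLeft.comp φ
  let ι : H →ₐ[R] A ⊗[R] H := Algebra.TensorProduct.includeRight
  have hψι (x y : H) : Commute (ψ x) (ι y) := by simp [ψ, ι, Commute, SemiconjBy]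
  have hleft (x : H) : mulAlgHom ψ ι hψι x = φ.toLinearMap.rTensor H (comul x) :=
    LinearMap.congr_fun (f := (Algebra.TensorProduct.lift ψ ι hψι).toLinearMap)
      (by ext; simp [ψ, ι]) (comul x)
  have hright (x : H) : mulAlgHom ι ψ (fun y x ↦ (hψι x y).symm) x =
      TensorProduct.comm R H A (φ.toLinearMap.lTensor H (comul x)) :=
    LinearMap.congr_fun
      (f := (Algebra.TensorProduct.lift ι ψ fun y x ↦ (hψι x y).symm).toLinearMap)
      (g := (TensorProduct.comm R H A).toLinearMap ∘ₗ φ.toLinearMap.lTensor H)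
      (by ext; simp [ψ, ι]) (comul x)
  have heq : mulAlgHom ψ ι hψι = mulAlgHom ι ψ (fun y x ↦ (hψι x y).symm) :=
    hgen.algHom_ext <| by
      rintro _ ⟨⟨i, j⟩, rfl⟩
      simp [ht.mulAlgHom_apply, ψ, ι, hφ, TensorProduct.ite_tmul]
  ext x
  exact (hleft x).symm.trans ((DFunLike.congr_fun heq x).trans (hright x))

end CocentralAlgHom

section Cartier

open ConvAlgebra

variable {𝕜 H : Type*} [Field 𝕜] [Ring H] [Bialgebra 𝕜 H]

@[simp]
theorem tensorForm_tmul (f g : H →ₗ[𝕜] 𝕜) (a b : H) : tensorForm f g (a ⊗ₜ b) = f a * g b := rfl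

theorem IsCocentral.tensorForm {f g : H →ₗ[𝕜] 𝕜} (hf : IsCocentral f) (hg : IsCocentral g) :
    IsCocentral (tensorForm f g) :=
  (hf.tensorProductMap hg).comp_left _

theorem IsCocentral.commute_toConv {C : Type*} [AddCommMonoid C] [Module 𝕜 C] [Coalgebra 𝕜 C]
    {χ : C →ₗ[𝕜] 𝕜} (hχ : IsCocentral χ) (f : ConvAlgebra 𝕜 C 𝕜) : Commute (toConv χ) f :=
  hχ.commute f

theorem isCocentral_leg13_tensorForm {f g : H →ₗ[𝕜] 𝕜} (hf : IsCocentral f) (hg : IsCocentral g) :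
    IsCocentral (leg13 (tensorForm f g)).ofConv := by
  have hcounit : IsCocentral (counit (R := 𝕜) (A := H)) := .counit
  have hεg := (hcounit.tensorProductMap hg).comp_left (TensorProduct.lid 𝕜 𝕜).toLinearMap
  convert (hf.tensorProductMap hεg).comp_left (TensorProduct.lid 𝕜 𝕜).toLinearMap
  ext a b c
  simp [leg13, leg23, mul_left_comm]

theorem leg12_inv_mul_cancel (R : ConvUnits 𝕜 H) :
    leg12 R⁻¹.val.ofConv * leg12 R.val.ofConv = 1 := by
  rw [leg12_eq_precomp, leg12_eq_precomp, ← map_mul]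
  exact (congrArg _ R.inv_mul).trans (map_one _)

theorem leg23_inv_mul_cancel (R : ConvUnits 𝕜 H) :
    leg23 R⁻¹.val.ofConv * leg23 R.val.ofConv = 1 := by
  rw [leg23_eq_precomp, leg23_eq_precomp, ← map_mul]
  exact (congrArg _ R.inv_mul).trans (map_one _)

theorem IsPointDerivation.isInfinitesimalRForm {D : H →ₗ[𝕜] 𝕜}
    (hD : IsPointDerivation (Bialgebra.counitAlgHom 𝕜 H) D) (hDc : IsCocentral D)
    (R : ConvUnits 𝕜 H) : IsInfinitesimalRForm R (tensorForm D D) where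
  mul_comm := (hDc.tensorForm hDc).commute _
  mul_right := by
    have hcomm := (isCocentral_leg13_tensorForm hDc hDc).commute_toConv (leg12 R⁻¹.val.ofConv)
    rw [← hcomm.eq, mul_assoc, leg12_inv_mul_cancel, mul_one]
    ext a b c
    simp [formMulRight, leg12, leg13, leg23, hD b c, mul_add, mul_left_comm, _root_.mul_comm]
  mul_left := by
    have hcomm := (isCocentral_leg13_tensorForm hDc hDc).commute_toConv (leg23 R⁻¹.val.ofConv)
    rw [← hcomm.eq, mul_assoc, leg23_inv_mul_cancel, mul_one]
    ext a b c
    simp [formMulLeft, leg13, leg23, hD a b, add_mul, mul_left_comm, mul_assoc, add_comm]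

theorem IsCoquasitriangular.isCartier_tensorForm {R : ConvUnits 𝕜 H} (hR : IsCoquasitriangular R)
    {D : H →ₗ[𝕜] 𝕜} (hD : IsPointDerivation (Bialgebra.counitAlgHom 𝕜 H) D)
    (hDc : IsCocentral D) : IsCartier R (tensorForm D D) where
  coquasitriangular := hR
  infinitesimalRForm := hD.isInfinitesimalRForm hDc R
  cartier := by
    have hswap : tensorForm D D ∘ₗ (TensorProduct.comm 𝕜 H H).toLinearMap = tensorForm D D := by
      ext a b
      exact _root_.mul_comm _ _
    rw [hswap]
    exact ((hDc.tensorForm hDc).commute_toConv R.val).symm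

end Cartier

theorem isPointDerivation_snd_dualNumber {𝕜 A : Type*} [Field 𝕜] [Ring A] [Algebra 𝕜 A]
    (φ : A →ₐ[𝕜] DualNumber 𝕜) :
    IsPointDerivation ((TrivSqZeroExt.fstHom 𝕜 𝕜 𝕜).comp φ)
      ((TrivSqZeroExt.sndHom 𝕜 𝕜).restrictScalars 𝕜 ∘ₗ φ.toLinearMap) := fun x y ↦ by
  simp [TrivSqZeroExt.snd_mul, mul_comm, add_comm]

theorem snd_aeval_one_add_eps {𝕜 : Type*} [CommRing 𝕜] (p : Polynomial 𝕜) :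
    (Polynomial.aeval (1 + DualNumber.eps : DualNumber 𝕜) p).snd = p.derivative.eval 1 := by
  have heval (p : Polynomial 𝕜) :
      Polynomial.aeval (1 : DualNumber 𝕜) p = TrivSqZeroExt.inl (p.eval 1) := by
    simpa [TrivSqZeroExt.algebraMap_eq_inl] using
      Polynomial.aeval_algebraMap_apply (DualNumber 𝕜) (1 : 𝕜) p
  rw [Polynomial.aeval_add_of_sq_eq_zero p 1 DualNumber.eps (by simp [sq]), heval, heval]
  simp

namespace Mq

variable {𝕜 : Type*} [Field 𝕜] (q : 𝕜ˣ)

theorem isComatrix_T : IsComatrix 𝕜 (T q) := ⟨comul_T q, counit_T q⟩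

theorem adjoin_range_T : Algebra.adjoin 𝕜 (Set.range (Function.uncurry (T q))) = ⊤ := by
  have hmk : (mk q).range = ⊤ := (AlgHom.range_eq_top _).2 (RingQuot.mkAlgHom_surjective 𝕜 _)
  rw [← hmk, ← Algebra.map_top, ← FreeAlgebra.adjoin_range_ι, AlgHom.map_adjoin, ← Set.range_comp]
  rfl

theorem generatesWithInverses_T :
    GeneratesWithInverses 𝕜 (Set.range (Function.uncurry (T q))) :=
  .of_adjoin_eq_top (adjoin_range_T q)

theorem degCoaction_T (i j : Fin 2) :
    degCoaction q (T q i j) = Polynomial.X ⊗ₜ[𝕜] T q i j :=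
  lift_T q _ _ i j

theorem degCoaction_of_mem_homogeneous {n : ℕ} {ξ : Mq q} (hξ : ξ ∈ homogeneous q n) :
    degCoaction q ξ = (Polynomial.X ^ n) ⊗ₜ[𝕜] ξ := by
  induction hξ using Submodule.pow_induction_on_left' with
  | algebraMap r =>
    rw [AlgHom.commutes, Algebra.TensorProduct.algebraMap_apply, pow_zero,
      Algebra.algebraMap_eq_smul_one, Algebra.algebraMap_eq_smul_one, TensorProduct.smul_tmul]
  | add x y i _ _ hx hy => rw [map_add, hx, hy, TensorProduct.tmul_add]
  | mem_mul m hm i x _ hx =>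
    have hm : degCoaction q m = Polynomial.X ⊗ₜ[𝕜] m := by
      induction hm using Submodule.span_induction with
      | zero => simp
      | add a b _ _ ha hb => rw [map_add, ha, hb, TensorProduct.tmul_add]
      | smul c a _ ha => rw [map_smul, ha, TensorProduct.tmul_smul]
      | mem a ha => rcases ha with rfl | rfl | rfl | rfl <;> exact degCoaction_T q _ _
    rw [map_mul, hx, hm, Algebra.TensorProduct.tmul_mul_tmul, pow_succ']

theorem der_of_mem_homogeneous {n : ℕ} {ξ : Mq q} (hξ : ξ ∈ homogeneous q n) :
    der q ξ = n * counit (R := 𝕜) ξ := by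
  simp [der, degCoaction_of_mem_homogeneous q hξ, polyDer, Polynomial.derivative_X_pow]

theorem tensorForm_der_of_mem_homogeneous {m n : ℕ} {ξ η : Mq q} (hξ : ξ ∈ homogeneous q m)
    (hη : η ∈ homogeneous q n) :
    tensorForm (der q) (der q) (ξ ⊗ₜ η) = m * n * counit (R := 𝕜) (ξ * η) := by
  rw [tensorForm_tmul, der_of_mem_homogeneous q hξ, der_of_mem_homogeneous q hη,
    Bialgebra.counit_mul]
  ring

/-- The character of `M_q(2)` with values in the dual numbers `𝕜[ε]` whose standard part is the
counit and whose infinitesimal part is `∂_q`: the degree coaction followed by `X ↦ 1 + ε`. -/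
def dualCounit : Mq q →ₐ[𝕜] DualNumber 𝕜 :=
  (Algebra.TensorProduct.lift (Polynomial.aeval (1 + DualNumber.eps))
    ((Algebra.ofId 𝕜 (DualNumber 𝕜)).comp (Bialgebra.counitAlgHom 𝕜 (Mq q)))
    fun _ _ ↦ Commute.all _ _).comp (degCoaction q)

theorem dualCounit_T (i j : Fin 2) :
    dualCounit q (T q i j) = if i = j then 1 + DualNumber.eps else 0 := by
  simp [dualCounit, degCoaction_T, counit_T, apply_ite (Algebra.ofId 𝕜 (DualNumber 𝕜))]

theorem dualCounit_det : dualCounit q (det q) = (1 + DualNumber.eps) ^ 2 := by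
  simp [det, dualCounit_T, sq]

theorem fstHom_comp_dualCounit :
    (TrivSqZeroExt.fstHom 𝕜 𝕜 𝕜).comp (dualCounit q) = Bialgebra.counitAlgHom 𝕜 (Mq q) :=
  algHom_ext q fun i j ↦ by
    simp [dualCounit_T, counit_T, apply_ite TrivSqZeroExt.fst]

theorem sndHom_comp_dualCounit :
    (TrivSqZeroExt.sndHom 𝕜 𝕜).restrictScalars 𝕜 ∘ₗ (dualCounit q).toLinearMap = der q := by
  ext ξ
  refine LinearMap.congr_fun (g := (TensorProduct.lid 𝕜 𝕜).toLinearMap ∘ₗ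
    TensorProduct.map (polyDer 𝕜) (counit (R := 𝕜) (A := Mq q)))
    (f := (TrivSqZeroExt.sndHom 𝕜 𝕜).restrictScalars 𝕜 ∘ₗ AlgHom.toLinearMap
      (Algebra.TensorProduct.lift (Polynomial.aeval (1 + DualNumber.eps))
        ((Algebra.ofId 𝕜 (DualNumber 𝕜)).comp (Bialgebra.counitAlgHom 𝕜 (Mq q)))
        fun _ _ ↦ Commute.all _ _))
    (TensorProduct.ext' fun p a ↦ ?_) (degCoaction q ξ)
  simp [snd_aeval_one_add_eps, polyDer, Algebra.ofId_apply, TrivSqZeroExt.algebraMap_eq_inl]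

theorem isPointDerivation_der :
    IsPointDerivation (Bialgebra.counitAlgHom 𝕜 (Mq q)) (der q) := by
  rw [← fstHom_comp_dualCounit, ← sndHom_comp_dualCounit]
  exact isPointDerivation_snd_dualNumber _

theorem isCocentral_der : IsCocentral (der q) := by
  rw [← sndHom_comp_dualCounit]
  exact ((isComatrix_T q).isCocentral_of_eq_ite (generatesWithInverses_T q) (dualCounit q) _
    (dualCounit_T q)).comp_left _

theorem der_T (i j : Fin 2) : der q (T q i j) = if i = j then 1 else 0 := by
  simp [der, degCoaction_T, polyDer, counit_T]

theorem tensorForm_der_ne_zero : tensorForm (der q) (der q) ≠ 0 := fun h ↦ by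
  simpa [der_T] using LinearMap.congr_fun h (α q ⊗ₜ α q)

end Mq

namespace GLq

variable {𝕜 : Type*} [Field 𝕜] (q : 𝕜ˣ)

theorem counit_mk (p : Polynomial (Mq q)) : counit (R := 𝕜) (mk q p) = polyCounit q p :=
  lift_mk q _ _ _ _ p

/-- The canonical map `M_q(2) → GL_q(2)` as a map of bialgebras. -/
def ofMqBialgHom : Mq q →ₐc[𝕜] GLq q :=
  BialgHom.ofAlgHom (ofMq q) (AlgHom.ext fun x ↦ lift_ofMq q _ _ _ _ x)
    (AlgHom.ext fun x ↦ (lift_ofMq q _ _ _ _ x).symm)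

theorem isComatrix_ofMq_T : IsComatrix 𝕜 fun i j ↦ ofMq q (Mq.T q i j) :=
  (Mq.isComatrix_T q).map (ofMqBialgHom q).toCoalgHom

/-- The quantum determinant as a unit of `GL_q(2)`, with inverse `θ`. -/
def detUnit : (GLq q)ˣ where
  val := ofMq q (Mq.det q)
  inv := θ q
  val_inv := (ofMq_comm q _).eq.trans (θ_mul_det q)
  inv_val := θ_mul_det q

theorem generatesWithInverses_ofMq_T :
    GeneratesWithInverses 𝕜 (Set.range (Function.uncurry fun i j ↦ ofMq q (Mq.T q i j))) := by
  intro S hS hinv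
  have hofMq : (ofMq q).range ≤ S := by
    rw [← Algebra.map_top, ← Mq.adjoin_range_T, AlgHom.map_adjoin, ← Set.range_comp]
    exact Algebra.adjoin_le hS
  have hθ : θ q ∈ S := hinv (detUnit q) (hofMq ⟨_, rfl⟩)
  refine top_le_iff.1 fun x _ ↦ ?_
  obtain ⟨p, rfl⟩ : ∃ p, mk q p = x := RingQuot.mkAlgHom_surjective 𝕜 _ x
  induction p using Polynomial.induction_on' with
  | add p r hp hr => exact map_add (mk q) p r ▸ add_mem (hp trivial) (hr trivial)
  | monomial n a =>
    rw [← Polynomial.C_mul_X_pow_eq_monomial, map_mul, map_pow]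
    exact mul_mem (hofMq ⟨a, rfl⟩) (pow_mem hθ n)

/-- The extension to `GL_q(2)` of the character of `M_q(2)` with values in the dual numbers `𝕜[ε]`.
It has to map `θ` to the inverse `(1 - ε)² = 1 - 2 ε` of the value `(1 + ε)²` at `det_q`. -/
def dualCounit : GLq q →ₐ[𝕜] DualNumber 𝕜 :=
  lift q (Mq.dualCounit q) ((1 - DualNumber.eps) ^ 2) (fun _ ↦ Commute.all _ _) (by
    rw [Mq.dualCounit_det]
    linear_combination (DualNumber.eps ^ 2 - 2) * DualNumber.eps_mul_eps (R := 𝕜))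

theorem fstHom_comp_dualCounit :
    (TrivSqZeroExt.fstHom 𝕜 𝕜 𝕜).comp (dualCounit q) = Bialgebra.counitAlgHom 𝕜 (GLq q) :=
  (generatesWithInverses_ofMq_T q).algHom_ext <| by
    rintro _ ⟨⟨i, j⟩, rfl⟩
    simp [dualCounit, lift_ofMq, Mq.dualCounit_T, (isComatrix_ofMq_T q).counit_eq,
      apply_ite TrivSqZeroExt.fst]

/-- The derivation of `GL_q(2)` that extends `∂_q`. -/
def der : GLq q →ₗ[𝕜] 𝕜 :=
  (TrivSqZeroExt.sndHom 𝕜 𝕜).restrictScalars 𝕜 ∘ₗ (dualCounit q).toLinearMap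

theorem der_ofMq (x : Mq q) : der q (ofMq q x) = Mq.der q x := by
  rw [← Mq.sndHom_comp_dualCounit]
  simp [der, dualCounit, lift_ofMq]

theorem der_θ : der q (θ q) = -2 := by
  norm_num [der, dualCounit, lift_θ, sq]

theorem isPointDerivation_der :
    IsPointDerivation (Bialgebra.counitAlgHom 𝕜 (GLq q)) (der q) := by
  rw [← fstHom_comp_dualCounit]
  exact isPointDerivation_snd_dualNumber _

theorem isCocentral_der : IsCocentral (der q) :=
  ((isComatrix_ofMq_T q).isCocentral_of_eq_ite (generatesWithInverses_ofMq_T q) (dualCounit q) _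
    fun i j ↦ by rw [dualCounit, lift_ofMq, Mq.dualCounit_T]).comp_left _

theorem tensorForm_der_ne_zero : tensorForm (der q) (der q) ≠ 0 := fun h ↦ by
  simpa [der_ofMq, Mq.der_T] using LinearMap.congr_fun h (ofMq q (Mq.α q) ⊗ₜ ofMq q (Mq.α q))

theorem isHatDer_der_comp_mk : IsHatDer q (der q ∘ₗ (mk q).toLinearMap) where
  derivation x y := by
    simpa [counit_mk] using isPointDerivation_der q (mk q x) (mk q y)
  restrict := der_ofMq q
  map_θ := der_θ q

variable {q} in
theorem IsHatDer.eq {D D' : Polynomial (Mq q) →ₗ[𝕜] 𝕜} (h : IsHatDer q D)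
    (h' : IsHatDer q D') : D = D' := by
  ext p
  have hX (n : ℕ) : D (Polynomial.X ^ n) = D' (Polynomial.X ^ n) := by
    induction n with
    | zero => rw [pow_zero, ← Polynomial.C_1, h.restrict, h'.restrict]
    | succ n ih => rw [pow_succ, h.derivation, h'.derivation, ih, h.map_θ, h'.map_θ]
  induction p using Polynomial.induction_on with
  | C a => rw [h.restrict, h'.restrict]
  | add a b ha hb => rw [map_add, map_add, ha, hb]
  | monomial n a _ => rw [h.derivation, h'.derivation, hX, h.restrict, h'.restrict]

end GLq

/-- The Faddeev–Reshetikhin–Takhtajan relations `R u₁ v₂ = v₂ u₁ R` between the entries of two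
matrices `u` and `v`, for a matrix `R` with entries `R i j k l` in row `(i, k)` and column
`(j, l)`. -/
def RTT {𝕜 B n : Type*} [CommSemiring 𝕜] [Semiring B] [Algebra 𝕜 B] [Fintype n]
    (R : n → n → n → n → 𝕜) (u v : n → n → B) : Prop :=
  ∀ i j k l, ∑ a, ∑ b, R i a k b • (u a j * v b l) = ∑ a, ∑ b, R a j b l • (v k b * u i a)

theorem RTT.map {𝕜 A B n : Type*} [CommSemiring 𝕜] [Semiring A] [Algebra 𝕜 A] [Semiring B]
    [Algebra 𝕜 B] [Fintype n] {R : n → n → n → n → 𝕜} {u v : n → n → A} (h : RTT R u v)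
    (f : A →ₐ[𝕜] B) : RTT R (fun i j ↦ f (u i j)) fun i j ↦ f (v i j) := fun i j k l ↦ by
  simpa using congrArg f (h i j k l)

theorem isUnit_toConv_algHom {R H A : Type*} [CommSemiring R] [Semiring H] [HopfAlgebra R H]
    [Semiring A] [Algebra R A] (f : H →ₐ[R] A) :
    IsUnit (toConv f.toLinearMap : ConvAlgebra R H A) := by
  have hid : IsUnit (toConv LinearMap.id : ConvAlgebra R H H) :=
    ⟨⟨toConv LinearMap.id, toConv (HopfAlgebra.antipode R), LinearMap.id_mul_antipode,
      LinearMap.antipode_mul_id⟩, rfl⟩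
  exact hid.map (ConvAlgebra.postcomp H f)

section FRT

open ConvAlgebra

variable {𝕜 H B n : Type*} [CommSemiring 𝕜] [Semiring H] [Bialgebra 𝕜 H] [Semiring B]
  [Algebra 𝕜 B] [Fintype n] [DecidableEq n]

/-- The coefficients of a matrix representation, indexed in the transposed order: a form that
pairs a comatrix `t` with `H` by `R (t i j ⊗ b) = r b j i` reverses products in its second
variable. -/
def transposedCoeff (r : H →ₐ[𝕜] Matrix n n 𝕜) (i j : n) : ConvAlgebra 𝕜 H 𝕜 :=
  toConv (Matrix.entryLinearMap 𝕜 𝕜 j i ∘ₗ r.toLinearMap)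

@[simp]
theorem transposedCoeff_apply (r : H →ₐ[𝕜] Matrix n n 𝕜) (i j : n) (b : H) :
    transposedCoeff r i j b = r b j i := rfl

theorem RTT.sum_mul_convMul_apply {t : n → n → H} (ht : IsComatrix 𝕜 t)
    (hgen : GeneratesWithInverses 𝕜 (Set.range (Function.uncurry t)))
    {r : H →ₐ[𝕜] Matrix n n 𝕜} {φ : H →ₐ[𝕜] B} {u : n → n → B}
    (h : RTT (fun i j k l ↦ r (t k l) j i) u fun i j ↦ φ (t i j)) (i j : n) (b : H) :
    ∑ a, u a j *
        (postcomp H (Algebra.ofId 𝕜 B) (transposedCoeff r i a) * toConv φ.toLinearMap) b =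
      ∑ a, (toConv φ.toLinearMap *
        postcomp H (Algebra.ofId 𝕜 B) (transposedCoeff r a j)) b * u i a := by
  let F : H →ₐ[𝕜] Matrix n n B := (Algebra.ofId 𝕜 B).mapMatrix.comp r
  let G : H →ₐ[𝕜] Matrix n n B := (Matrix.scalarAlgHom n 𝕜).comp φ
  have hFG (x y : H) : Commute (F x) (G y) := by
    ext i j
    simp [F, G, Algebra.ofId_apply, Algebra.commutes]
  have hF_mul_G (i j : n) (b : H) : mulAlgHom F G hFG b i j =
      (postcomp H (Algebra.ofId 𝕜 B) (transposedCoeff r j i) * toConv φ.toLinearMap) b := by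
    simp [ConvAlgebra.mulAlgHom_apply, (ℛ 𝕜 b).convMul_apply, Matrix.sum_apply, F, G]
  have hG_mul_F (i j : n) (b : H) : mulAlgHom G F (fun y x ↦ (hFG x y).symm) b i j =
      (toConv φ.toLinearMap * postcomp H (Algebra.ofId 𝕜 B) (transposedCoeff r j i)) b := by
    simp [ConvAlgebra.mulAlgHom_apply, (ℛ 𝕜 b).convMul_apply, Matrix.sum_apply, F, G]
  let U : Matrix n n B := (Matrix.of u).transpose
  have hU : SemiconjBy U (mulAlgHom F G hFG b) (mulAlgHom G F (fun y x ↦ (hFG x y).symm) b) := by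
    refine hgen.semiconjBy ?_ b
    rintro _ ⟨⟨k, l⟩, rfl⟩
    ext i j
    simpa [Matrix.mul_apply, U, hF_mul_G, hG_mul_F, ht.convMul_apply, Finset.mul_sum,
      Finset.sum_mul, Algebra.ofId_apply, Algebra.smul_def, Algebra.left_comm,
      Algebra.commutes, mul_assoc] using h j i k l
  simpa [Matrix.mul_apply, U, hF_mul_G, hG_mul_F] using congrFun₂ hU j i

theorem RTT.coeff {t : n → n → H} (ht : IsComatrix 𝕜 t)
    (hgen : GeneratesWithInverses 𝕜 (Set.range (Function.uncurry t))) {r : H →ₐ[𝕜] Matrix n n 𝕜}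
    (h : RTT (fun i j k l ↦ r (t k l) j i) t t) :
    RTT (fun i j k l ↦ r (t k l) j i) (transposedCoeff r) (transposedCoeff r) := by
  intro i j k l
  ext b
  have hleft (i j p q : n) :
      (postcomp H (Algebra.ofId 𝕜 (Matrix n n 𝕜)) (transposedCoeff r i j) *
        toConv r.toLinearMap) b p q = (transposedCoeff r i j * transposedCoeff r q p) b := by
    simp [(ℛ 𝕜 b).convMul_apply, Matrix.sum_apply, Algebra.ofId_apply,
      Matrix.algebraMap_eq_diagonal]
  have hright (i j p q : n) :
      (toConv r.toLinearMap * postcomp H (Algebra.ofId 𝕜 (Matrix n n 𝕜))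
        (transposedCoeff r i j)) b p q = (transposedCoeff r q p * transposedCoeff r i j) b := by
    simp [(ℛ 𝕜 b).convMul_apply, Matrix.sum_apply, Algebra.ofId_apply,
      Matrix.algebraMap_eq_diagonal]
  have hsum := congrFun₂ ((h.map r).sum_mul_convMul_apply ht hgen k l b) j i
  simp only [Matrix.sum_apply, Matrix.mul_apply, hleft, hright] at hsum
  simp only [ofConv_sum, ofConv_smul, LinearMap.sum_apply, LinearMap.smul_apply, smul_eq_mul]
  rw [Finset.sum_comm, Finset.sum_comm (f := fun a b' ↦ r (t b' l) j a * _), hsum]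
  exact Finset.sum_congr rfl fun _ _ ↦ Finset.sum_congr rfl fun _ _ ↦ mul_comm _ _

theorem apply_mul_eq_of_transposedCoeff {K : Type*} [Semiring K] [Bialgebra 𝕜 K] {t : n → n → K}
    (ht : IsComatrix 𝕜 t) (hgen : GeneratesWithInverses 𝕜 (Set.range (Function.uncurry t)))
    {r : H →ₐ[𝕜] Matrix n n 𝕜} {ψ : K →ₐ[𝕜] ConvAlgebra 𝕜 H 𝕜}
    (hψ : ∀ i j, ψ (t i j) = transposedCoeff r i j) (a : K) (b c : H) : ψ a (b * c) =
    (postcomp K (precomp 𝕜 (sndProj 𝕜 H H)) (toConv ψ.toLinearMap) *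
      postcomp K (precomp 𝕜 (fstProj 𝕜 H H)) (toConv ψ.toLinearMap)) a (b ⊗ₜ c) := by
  have hcomm (x y : K) : Commute ((precomp 𝕜 (sndProj 𝕜 H H)).comp ψ x)
      ((precomp 𝕜 (fstProj 𝕜 H H)).comp ψ y) := by
    ext b c
    exact (precomp_sndProj_mul_precomp_fstProj_apply _ _ b c).trans
      ((mul_comm _ _).trans (precomp_fstProj_mul_precomp_sndProj_apply _ _ b c).symm)
  have heq : (precomp 𝕜 (Bialgebra.mulCoalgHom 𝕜 H)).comp ψ = mulAlgHom _ _ hcomm := by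
    refine hgen.algHom_ext ?_
    rintro _ ⟨⟨i, j⟩, rfl⟩
    ext b c
    simp [ht.mulAlgHom_apply, hψ, Matrix.mul_apply, -LinearMap.convMul_apply,
      precomp_sndProj_mul_precomp_fstProj_apply, mul_comm]
  have ha := LinearMap.congr_fun (congrArg ofConv (DFunLike.congr_fun heq a)) (b ⊗ₜ c)
  rwa [mulAlgHom_apply] at ha

theorem apply_mul_of_isGroupLikeElem {K : Type*} [Semiring K] [Bialgebra 𝕜 K] {t : n → n → K}
    (ht : IsComatrix 𝕜 t) (hgen : GeneratesWithInverses 𝕜 (Set.range (Function.uncurry t)))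
    {r : H →ₐ[𝕜] Matrix n n 𝕜} {ψ : K →ₐ[𝕜] ConvAlgebra 𝕜 H 𝕜}
    (hψ : ∀ i j, ψ (t i j) = transposedCoeff r i j) {a : K} (ha : IsGroupLikeElem 𝕜 a) (b c : H) :
    ψ a (b * c) = ψ a b * ψ a c := by
  rw [apply_mul_eq_of_transposedCoeff ht hgen hψ, ← evalGroupLike_apply ha, map_mul, mul_comm]
  exact precomp_sndProj_mul_precomp_fstProj_apply _ _ b c

section CoquasitriangularStructure

variable {𝕜 H n : Type*} [Field 𝕜] [Ring H] [Bialgebra 𝕜 H] [Fintype n] [DecidableEq n]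
  {t : n → n → H} (ht : IsComatrix 𝕜 t)
  (hgen : GeneratesWithInverses 𝕜 (Set.range (Function.uncurry t))) {r : H →ₐ[𝕜] Matrix n n 𝕜}
  {ψ : H →ₐ[𝕜] ConvAlgebra 𝕜 H 𝕜} (hψ : ∀ i j, ψ (t i j) = transposedCoeff r i j)

include ht hgen hψ

theorem RTT.curry_mul_comm (h : RTT (fun i j k l ↦ r (t k l) j i) t t) :
    postcomp H (postcomp H (Algebra.ofId 𝕜 H)) (toConv ψ.toLinearMap) *
        (toConv (const 𝕜 H H).toLinearMap * const 𝕜 H _ (toConv LinearMap.id)) =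
      const 𝕜 H _ (toConv LinearMap.id) * toConv (const 𝕜 H H).toLinearMap *
        postcomp H (postcomp H (Algebra.ofId 𝕜 H)) (toConv ψ.toLinearMap) := by
  have hcomm (x y : H) : Commute ((postcomp H (Algebra.ofId 𝕜 H)).comp ψ x) (const 𝕜 H H y) :=
    commute_postcomp_ofId_const _ _
  have hsemi (a : H) : SemiconjBy (toConv LinearMap.id)
      (mulAlgHom _ _ (fun y x ↦ (hcomm x y).symm) a) (mulAlgHom _ _ hcomm a) := by
    refine hgen.semiconjBy ?_ a
    rintro _ ⟨⟨i, j⟩, rfl⟩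
    ext b
    convert (h.sum_mul_convMul_apply (φ := .id 𝕜 H) ht hgen i j b).symm using 1
    · rw [Function.uncurry_apply_pair, ht.mulAlgHom_apply, Finset.mul_sum, ofConv_sum,
        LinearMap.sum_apply]
      refine Finset.sum_congr rfl fun k _ ↦ ?_
      rw [← (hcomm _ _).eq, ← mul_assoc, mul_const_apply, AlgHom.comp_apply, hψ]
      rfl
    · rw [Function.uncurry_apply_pair, ht.mulAlgHom_apply, Finset.sum_mul, ofConv_sum,
        LinearMap.sum_apply]
      refine Finset.sum_congr rfl fun k _ ↦ ?_
      rw [(hcomm _ _).eq, mul_assoc, const_mul_apply, AlgHom.comp_apply, hψ]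
      rfl
  refine WithConv.ext (LinearMap.ext fun a ↦ ?_)
  rw [← mul_assoc, mul_assoc (const 𝕜 H _ _), mul_const_apply, const_mul_apply]
  have ha := (hsemi a).eq.symm
  rw [mulAlgHom_apply, mulAlgHom_apply] at ha
  exact ha

theorem RTT.isCoquasitriangular (h : RTT (fun i j k l ↦ r (t k l) j i) t t) {R : ConvUnits 𝕜 H}
    (hR : curry 𝕜 𝕜 H H R.val = toConv ψ.toLinearMap) : IsCoquasitriangular R where
  mul_comm := by
    have hunit : curry 𝕜 H H H (unitComp R.val.ofConv) =
      postcomp H (postcomp H (Algebra.ofId 𝕜 H)) (curry 𝕜 𝕜 H H R.val) := rfl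
    have hmul : curry 𝕜 H H H (toConv (LinearMap.mul' 𝕜 H)) =
        toConv (const 𝕜 H H).toLinearMap * const 𝕜 H _ (toConv LinearMap.id) := by
      ext a b
      rw [mul_const_apply]
      exact (const_mul_apply (toConv LinearMap.id) a b).symm
    have hmulop : curry 𝕜 H H H (toConv (LinearMap.mul' 𝕜 H ∘ₗ
        (TensorProduct.comm 𝕜 H H).toLinearMap)) =
        const 𝕜 H _ (toConv LinearMap.id) * toConv (const 𝕜 H H).toLinearMap := by
      ext a b
      rw [const_mul_apply]
      exact (mul_const_apply (toConv LinearMap.id) a b).symm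
    apply (curry 𝕜 H H H).injective
    rw [map_mul, map_mul, hunit, hR, hmul, hmulop, h.curry_mul_comm ht hgen hψ]
  mul_right := by
    ext a b c
    change curry 𝕜 𝕜 H H R.val a (b * c) =
      curry 𝕜 𝕜 H (H ⊗[𝕜] H) (leg13 R.val.ofConv * leg12 R.val.ofConv) a (b ⊗ₜ c)
    rw [map_mul (curry 𝕜 𝕜 H (H ⊗[𝕜] H)), curry_leg12, curry_leg13, toConv_ofConv, hR]
    exact apply_mul_eq_of_transposedCoeff ht hgen hψ a b c
  mul_left := by
    ext a b c
    change curry 𝕜 𝕜 H H R.val (a * b) c =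
      (leg13 R.val.ofConv * leg23 R.val.ofConv) (a ⊗ₜ (b ⊗ₜ c))
    rw [leg13_mul_leg23_apply, toConv_ofConv, hR]
    exact LinearMap.congr_fun (congrArg ofConv (map_mul ψ a b)) c

end CoquasitriangularStructure

end FRT

section Antipode

open ConvAlgebra

theorem GeneratesWithInverses.apply_eq_smul {R A M : Type*} [CommSemiring R] [Semiring A]
    [Algebra R A] [AddCommMonoid M] [Module R M] {s : Set A} (hs : GeneratesWithInverses R s)
    {P : A →ₐ[R] Module.End R M} {e : A →ₐ[R] R} {v : M} (h : ∀ a ∈ s, P a v = e a • v) (a : A) :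
    P a v = e a • v := by
  let S : Subalgebra R A :=
    { carrier := {a | P a v = e a • v}
      mul_mem' := fun {a b} (ha : P a v = _) (hb : P b v = _) ↦ by
        change P (a * b) v = e (a * b) • v
        rw [map_mul, Module.End.mul_apply, hb, map_smul, ha, smul_smul, map_mul, mul_comm]
      add_mem' := fun {a b} (ha : P a v = _) (hb : P b v = _) ↦ by
        change P (a + b) v = e (a + b) • v
        rw [map_add, LinearMap.add_apply, ha, hb, map_add, add_smul]
      algebraMap_mem' := fun r ↦ by
        change P (algebraMap R A r) v = e (algebraMap R A r) • v
        rw [AlgHom.commutes, AlgHom.commutes, Module.algebraMap_end_apply, Algebra.algebraMap_self,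
          RingHom.id_apply] }
  have hinv (u : Aˣ) (hu : P u v = e u • v) : P ↑u⁻¹ v = e ↑u⁻¹ • v := by
    have hv : P ↑u⁻¹ (P u v) = v := by
      rw [← Module.End.mul_apply, ← map_mul, Units.inv_mul, map_one, Module.End.one_apply]
    have he : e ↑u⁻¹ * e u = 1 := by rw [← map_mul, Units.inv_mul, map_one]
    rw [← one_smul R (P ↑u⁻¹ v), ← he, mul_smul, ← map_smul, ← hu, hv]
  exact (hs S h hinv).ge (Algebra.mem_top (x := a))

theorem GeneratesWithInverses.op {R A : Type*} [CommSemiring R] [Semiring A] [Algebra R A]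
    {s : Set A} (hs : GeneratesWithInverses R s) :
    GeneratesWithInverses R (MulOpposite.unop ⁻¹' s) := fun S hS hinv ↦ by
  have htop : S.unop = ⊤ := hs _ (fun a ha ↦ hS ha) fun u hu ↦ hinv (Units.opEquiv.symm (.op u)) hu
  exact top_le_iff.1 fun a _ ↦ (htop.ge Algebra.mem_top : a.unop ∈ S.unop)

variable {R H A n : Type*} [CommSemiring R] [Semiring H] [Bialgebra R H] [Semiring A] [Algebra R A]
  [Fintype n] [DecidableEq n]

/-- The linear map `H → A` underlying an algebra anti-homomorphism. -/
def unopLinearMap (g : H →ₐ[R] Aᵐᵒᵖ) : H →ₗ[R] A :=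
  (MulOpposite.opLinearEquiv R).symm.toLinearMap ∘ₗ g.toLinearMap

variable {t : n → n → H} (ht : IsComatrix R t)
  (hgen : GeneratesWithInverses R (Set.range (Function.uncurry t))) {f : H →ₐ[R] A}
  {g : H →ₐ[R] Aᵐᵒᵖ}

include ht hgen

theorem toConv_algHom_mul_toConv_unopLinearMap
    (h : (Matrix.of fun i j ↦ f (t i j)) * (Matrix.of fun i j ↦ (g (t i j)).unop) = 1) :
    toConv f.toLinearMap * toConv (unopLinearMap g) = 1 := by
  let F : H →ₐ[R] Module.End R A := (Algebra.lsmul R R A).comp f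
  let G : H →ₐ[R] Module.End R A := (Algebra.lsmul R R A).comp g
  have hFG (x y : H) : Commute (F x) (G y) :=
    LinearMap.ext fun a ↦ (mul_assoc (f x) a (g y).unop).symm
  have hmul (x : H) : mulAlgHom F G hFG x 1 =
      (toConv f.toLinearMap * toConv (unopLinearMap g)) x := by
    simp [mulAlgHom_apply, (ℛ R x).convMul_apply, F, G, unopLinearMap]
  refine WithConv.ext (LinearMap.ext fun x ↦ ?_)
  refine (hmul x).symm.trans ((hgen.apply_eq_smul (e := Bialgebra.counitAlgHom R H) ?_ x).trans
    (Algebra.algebraMap_eq_smul_one _).symm)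
  rintro _ ⟨⟨i, j⟩, rfl⟩
  rw [hmul, Function.uncurry_apply_pair, ht.convMul_apply]
  simpa [Matrix.mul_apply, Matrix.one_apply, ht.counit_eq, unopLinearMap] using congrFun₂ h i j

theorem toConv_unopLinearMap_mul_toConv_algHom
    (h : (Matrix.of fun i j ↦ (g (t i j)).unop) * (Matrix.of fun i j ↦ f (t i j)) = 1) :
    toConv (unopLinearMap g) * toConv f.toLinearMap = 1 := by
  let F : H →ₐ[R] (Module.End R A)ᵐᵒᵖ :=
    (AlgHom.op (Algebra.lsmul R R A)).comp ((AlgEquiv.opOp R A).toAlgHom.comp f)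
  let G : H →ₐ[R] (Module.End R A)ᵐᵒᵖ := (AlgHom.op (Algebra.lsmul R R A)).comp g
  have hGF (x y : H) : Commute (G x) (F y) :=
    MulOpposite.unop_injective <| LinearMap.ext fun a ↦ mul_assoc (g x).unop a (f y)
  have hmul (x : H) : AlgHom.opComm (mulAlgHom G F hGF) (.op x) 1 =
      (toConv (unopLinearMap g) * toConv f.toLinearMap) x := by
    simp [mulAlgHom_apply, (ℛ R x).convMul_apply, F, G, unopLinearMap]
  refine WithConv.ext (LinearMap.ext fun x ↦ ?_)
  refine (hmul x).symm.trans ((hgen.op.apply_eq_smul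
    (e := AlgHom.opComm ((AlgEquiv.toOpposite R R).toAlgHom.comp (Bialgebra.counitAlgHom R H)))
    ?_ (.op x)).trans (Algebra.algebraMap_eq_smul_one _).symm)
  rintro x ⟨⟨i, j⟩, hx⟩
  obtain rfl : x = .op (t i j) := MulOpposite.unop_injective hx.symm
  rw [hmul, ht.convMul_apply]
  simpa [Matrix.mul_apply, Matrix.one_apply, ht.counit_eq, unopLinearMap,
    apply_ite MulOpposite.unop] using congrFun₂ h i j

end Antipode

/-- A `q`-matrix: a 2 × 2 matrix whose entries satisfy the Manin relations. -/
structure IsQuantumMatrix {𝕜 B : Type*} [Field 𝕜] [Ring B] [Algebra 𝕜 B] (q : 𝕜)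
    (u : Fin 2 → Fin 2 → B) : Prop where
  ba : u 0 1 * u 0 0 = q • (u 0 0 * u 0 1)
  ca : u 1 0 * u 0 0 = q • (u 0 0 * u 1 0)
  db : u 1 1 * u 0 1 = q • (u 0 1 * u 1 1)
  dc : u 1 1 * u 1 0 = q • (u 1 0 * u 1 1)
  cb : u 1 0 * u 0 1 = u 0 1 * u 1 0
  da : u 1 1 * u 0 0 = u 0 0 * u 1 1 - (q⁻¹ - q) • (u 0 1 * u 1 0)

/-- The quantum determinant of a 2 × 2 matrix. -/
def qdet {𝕜 B : Type*} [Field 𝕜] [Ring B] [Algebra 𝕜 B] (q : 𝕜) (u : Fin 2 → Fin 2 → B) : B :=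
  u 0 0 * u 1 1 - q⁻¹ • (u 0 1 * u 1 0)

/-- The quantum adjugate of a 2 × 2 matrix. -/
def qadj {𝕜 B : Type*} [Field 𝕜] [Ring B] [Algebra 𝕜 B] (q : 𝕜) (u : Fin 2 → Fin 2 → B) :
    Fin 2 → Fin 2 → B :=
  ![![u 1 1, -(q • u 0 1)], ![-(q⁻¹ • u 1 0), u 0 0]]

section QuantumMatrix

variable {𝕜 A B : Type*} [Field 𝕜] [Ring A] [Algebra 𝕜 A] [Ring B] [Algebra 𝕜 B]

theorem Mq.isQuantumMatrix_T (q : 𝕜ˣ) : IsQuantumMatrix (q : 𝕜) (T q) :=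
  ⟨ba q, ca q, db q, dc q, cb q, da q⟩

/-- The algebra map out of `M_q(2)` that sends the generators to the entries of a `q`-matrix. -/
def IsQuantumMatrix.lift {q : 𝕜ˣ} {u : Fin 2 → Fin 2 → B} (h : IsQuantumMatrix (q : 𝕜) u) :
    Mq q →ₐ[𝕜] B :=
  Mq.lift q u fun x y hxy ↦ by
    cases hxy <;> simp [h.ba, h.ca, h.db, h.dc, h.cb, h.da]

theorem IsQuantumMatrix.lift_T {q : 𝕜ˣ} {u : Fin 2 → Fin 2 → B}
    (h : IsQuantumMatrix (q : 𝕜) u) (i j : Fin 2) : h.lift (Mq.T q i j) = u i j :=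
  Mq.lift_T q _ _ i j

theorem map_qdet (f : A →ₐ[𝕜] B) (q : 𝕜) (u : Fin 2 → Fin 2 → A) :
    f (qdet q u) = qdet q fun i j ↦ f (u i j) := by
  simp [qdet]

namespace IsQuantumMatrix

theorem map {q : 𝕜} {u : Fin 2 → Fin 2 → A} (h : IsQuantumMatrix q u) (f : A →ₐ[𝕜] B) :
    IsQuantumMatrix q fun i j ↦ f (u i j) where
  ba := by simpa using congrArg f h.ba
  ca := by simpa using congrArg f h.ca
  db := by simpa using congrArg f h.db
  dc := by simpa using congrArg f h.dc
  cb := by simpa using congrArg f h.cb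
  da := by simpa using congrArg f h.da

section Adjugate

variable {q : 𝕜} {u : Fin 2 → Fin 2 → B} (h : IsQuantumMatrix q u)

include h

theorem central_mul {z : B} (hz : ∀ i j, Commute z (u i j)) :
    IsQuantumMatrix q fun i j ↦ z * u i j := by
  have hmul (i j k l : Fin 2) : z * u i j * (z * u k l) = z * z * (u i j * u k l) :=
    (hz i j).symm.mul_mul_mul_comm z (u k l)
  constructor <;>
    simp only [hmul, h.ba, h.ca, h.db, h.dc, h.cb, h.da, mul_sub, mul_smul_comm]

theorem op_qadj (hq : q ≠ 0) : IsQuantumMatrix q fun i j ↦ MulOpposite.op (qadj q u i j) := by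
  constructor <;>
    simp [qadj, ← MulOpposite.op_mul, ← MulOpposite.op_smul, ← MulOpposite.op_sub, h.ba, h.ca,
      h.db, h.dc, h.cb, h.da, smul_smul, hq]

theorem matrix_mul_qadj (hq : q ≠ 0) :
    Matrix.of u * Matrix.of (qadj q u) = qdet q u • (1 : Matrix (Fin 2) (Fin 2) B) := by
  ext i j
  fin_cases i <;> fin_cases j <;>
    simp [qadj, qdet, Matrix.mul_apply, h.ba, h.da, h.dc, h.cb, smul_smul, hq, sub_smul] <;> abel

theorem qadj_mul_matrix (hq : q ≠ 0) :
    Matrix.of (qadj q u) * Matrix.of u = qdet q u • (1 : Matrix (Fin 2) (Fin 2) B) := by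
  ext i j
  fin_cases i <;> fin_cases j <;>
    simp [qadj, qdet, Matrix.mul_apply, h.da, h.db, h.ca, h.cb, smul_smul, hq, sub_smul] <;> abel

theorem qdet_op_qadj (hq : q ≠ 0) :
    qdet q (fun i j ↦ MulOpposite.op (qadj q u i j)) = MulOpposite.op (qdet q u) := by
  simp [qadj, qdet, ← MulOpposite.op_mul, ← MulOpposite.op_smul, ← MulOpposite.op_sub, h.cb,
    smul_smul, hq]

end Adjugate

end IsQuantumMatrix

theorem qdet_central_mul (q : 𝕜) {u : Fin 2 → Fin 2 → B} {z : B} (hz : ∀ i j, Commute z (u i j)) :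
    qdet q (fun i j ↦ z * u i j) = z * z * qdet q u := by
  have hmul (i j k l : Fin 2) : z * u i j * (z * u k l) = z * z * (u i j * u k l) :=
    (hz i j).symm.mul_mul_mul_comm z (u k l)
  simp only [qdet, hmul, mul_sub, mul_smul_comm]

end QuantumMatrix

theorem IsQuantumMatrix.lift_det {𝕜 B : Type*} [Field 𝕜] [Ring B] [Algebra 𝕜 B] {q : 𝕜ˣ}
    {u : Fin 2 → Fin 2 → B} (h : IsQuantumMatrix (q : 𝕜) u) :
    h.lift (Mq.det q) = qdet (q : 𝕜) u :=
  (map_qdet h.lift (q : 𝕜) (Mq.T q)).trans (by simp only [h.lift_T])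

namespace GLq

variable {𝕜 : Type*} [Field 𝕜] (q : 𝕜ˣ)

theorem commute_θ (x : GLq q) : Commute (θ q) x := by
  have h : SemiconjBy (θ q) (AlgHom.id 𝕜 (GLq q) x) (AlgHom.id 𝕜 (GLq q) x) := by
    refine (generatesWithInverses_ofMq_T q).semiconjBy ?_ x
    rintro _ ⟨⟨i, j⟩, rfl⟩
    exact (ofMq_comm q (Mq.T q i j)).symm
  exact h

theorem commute_op_ofMq_det (x : (GLq q)ᵐᵒᵖ) : Commute x (.op (ofMq q (Mq.det q))) :=
  (Commute.units_inv_left_iff (u := detUnit q).1 (commute_θ q x.unop)).symm.op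

theorem isQuantumMatrix_ofMq_T : IsQuantumMatrix (q : 𝕜) fun i j ↦ ofMq q (Mq.T q i j) :=
  (Mq.isQuantumMatrix_T q).map (ofMq q)

theorem ofMq_det : ofMq q (Mq.det q) = qdet (q : 𝕜) fun i j ↦ ofMq q (Mq.T q i j) :=
  map_qdet (ofMq q) (q : 𝕜) (Mq.T q)

theorem isQuantumMatrix_op_θ_mul_qadj : IsQuantumMatrix (q : 𝕜) fun i j ↦
    MulOpposite.op (θ q) *
      MulOpposite.op (qadj (q : 𝕜) (fun i j ↦ ofMq q (Mq.T q i j)) i j) :=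
  ((isQuantumMatrix_ofMq_T q).op_qadj q.ne_zero).central_mul fun _ _ ↦ (commute_θ q _).op

/-- The antipode of `GL_q(2)`, which sends the matrix of generators to `θ` times its quantum
adjugate. -/
def antipodeHom : GLq q →ₐ[𝕜] (GLq q)ᵐᵒᵖ :=
  lift q (isQuantumMatrix_op_θ_mul_qadj q).lift (.op (ofMq q (Mq.det q)))
    (fun _ ↦ commute_op_ofMq_det q _) (by
      rw [IsQuantumMatrix.lift_det, qdet_central_mul _ fun _ _ ↦ (commute_θ q _).op,
        (isQuantumMatrix_ofMq_T q).qdet_op_qadj q.ne_zero, ← ofMq_det, ← MulOpposite.op_mul,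
        ← MulOpposite.op_mul, ← MulOpposite.op_mul, mul_assoc, mul_assoc, θ_mul_det, mul_one,
        (ofMq_comm q _).eq, θ_mul_det, MulOpposite.op_one])

theorem matrix_unop_antipodeHom :
    (Matrix.of fun i j ↦ (antipodeHom q (ofMq q (Mq.T q i j))).unop) =
      θ q • Matrix.of (qadj (q : 𝕜) fun i j ↦ ofMq q (Mq.T q i j)) := by
  ext i j
  rw [Matrix.of_apply, antipodeHom, lift_ofMq, IsQuantumMatrix.lift_T]
  exact (commute_θ q _).eq.symm

theorem matrix_unop_antipodeHom_mul :
    (Matrix.of fun i j ↦ (antipodeHom q (ofMq q (Mq.T q i j))).unop) *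
      (Matrix.of fun i j ↦ ofMq q (Mq.T q i j)) = 1 := by
  rw [matrix_unop_antipodeHom, Matrix.smul_mul,
    (isQuantumMatrix_ofMq_T q).qadj_mul_matrix q.ne_zero, ← ofMq_det, smul_smul, θ_mul_det,
    one_smul]

theorem matrix_mul_unop_antipodeHom :
    (Matrix.of fun i j ↦ ofMq q (Mq.T q i j)) *
      (Matrix.of fun i j ↦ (antipodeHom q (ofMq q (Mq.T q i j))).unop) = 1 := by
  have hmul (M N : Matrix (Fin 2) (Fin 2) (GLq q)) : M * θ q • N = θ q • (M * N) := by
    ext i j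
    simp only [Matrix.mul_apply, Matrix.smul_apply, smul_eq_mul, Finset.mul_sum,
      (commute_θ q _).left_comm]
  rw [matrix_unop_antipodeHom, hmul, (isQuantumMatrix_ofMq_T q).matrix_mul_qadj q.ne_zero,
    ← ofMq_det, smul_smul, θ_mul_det, one_smul]

instance : HopfAlgebra 𝕜 (GLq q) :=
  .ofConvInverse (unopLinearMap (antipodeHom q))
    (toConv_unopLinearMap_mul_toConv_algHom (f := .id 𝕜 _) (isComatrix_ofMq_T q)
      (generatesWithInverses_ofMq_T q) (matrix_unop_antipodeHom_mul q))
    (toConv_algHom_mul_toConv_unopLinearMap (f := .id 𝕜 _) (isComatrix_ofMq_T q)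
      (generatesWithInverses_ofMq_T q) (matrix_mul_unop_antipodeHom q))

end GLq

section StandardRMatrix

/-- The entries of the standard R-matrix of `GL_q(2)`, normalized by a square root `s` of `q`. -/
def standardR {𝕜 : Type*} [Field 𝕜] (q s : 𝕜) (i j k l : Fin 2) : 𝕜 :=
  s⁻¹ * if i = j ∧ k = l then if i = k then q else 1
    else if i = 0 ∧ j = 1 ∧ k = 1 ∧ l = 0 then q - q⁻¹ else 0

variable {𝕜 B : Type*} [Field 𝕜] [Ring B] [Algebra 𝕜 B] {q s : 𝕜}

theorem IsQuantumMatrix.rtt {u : Fin 2 → Fin 2 → B} (h : IsQuantumMatrix q u) (hq : q ≠ 0) :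
    RTT (standardR q s) u u := by
  simp only [RTT, Fin.forall_fin_two, Fin.sum_univ_two, standardR, h.ba, h.ca, h.db, h.dc, h.cb,
    h.da, smul_smul, smul_sub, and_true, true_and, and_self, and_false, false_and, zero_ne_one,
    one_ne_zero, if_true, if_false, mul_one, mul_zero, zero_smul, add_zero, zero_add]
  and_intros <;> match_scalars <;> field_simp <;> ring

theorem RTT.isQuantumMatrix {u : Fin 2 → Fin 2 → B} (h : RTT (standardR q s) u u) (hs : s ≠ 0) :
    IsQuantumMatrix q u := by
  have hR (i j k l : Fin 2) := congrArg (s • ·) (h i j k l)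
  simp only [Fin.sum_univ_two, standardR, smul_smul, smul_add, mul_inv_cancel_left₀ hs] at hR
  constructor
  · simpa using (hR 0 0 0 1).symm
  · simpa using hR 1 0 0 0
  · simpa using hR 1 1 0 1
  · simpa using (hR 1 0 1 1).symm
  · simpa using hR 1 0 0 1
  · rw [sub_eq_add_neg, ← neg_smul, neg_sub, add_comm]
    simpa using hR 1 1 0 0

/-- The matrices `(R (T i j ⊗ T k l))ⱼᵢ` of the standard R-matrix, indexed by `k` and `l`. -/
def standardL (q s : 𝕜) (k l : Fin 2) : Matrix (Fin 2) (Fin 2) 𝕜 :=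
  .of fun j i ↦ standardR q s i j k l

theorem isQuantumMatrix_standardL (q s : 𝕜) : IsQuantumMatrix q (standardL q s) := by
  constructor <;> ext i j <;> fin_cases i <;> fin_cases j <;>
    simp [standardL, standardR, Matrix.mul_apply, mul_comm, mul_left_comm]

theorem qdet_standardL (hs : s ^ 2 = q) (hs0 : s ≠ 0) : qdet q (standardL q s) = 1 := by
  subst hs
  ext i j
  fin_cases i <;> fin_cases j <;>
    simp [qdet, standardL, standardR, Matrix.mul_apply, sq, hs0]

theorem qdet_of_standardR (hs : s ^ 2 = q) (hs0 : s ≠ 0) :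
    qdet q (fun i j ↦ Matrix.of (standardR q s i j)) = 1 := by
  subst hs
  ext i j
  fin_cases i <;> fin_cases j <;> simp [qdet, standardR, Matrix.mul_apply, sq, hs0]

end StandardRMatrix

namespace Mq

variable {𝕜 : Type*} [Field 𝕜] {q s : 𝕜ˣ}

theorem hasStandardValues_iff {R : Mq q ⊗[𝕜] Mq q →ₗ[𝕜] 𝕜} : HasStandardValues q s R ↔
    ∀ i j k l, R (T q i j ⊗ₜ T q k l) = standardR (q : 𝕜) s i j k l := by
  simp only [HasStandardValues, Matrix.smul_of, Matrix.smul_cons, smul_eq_mul, mul_zero, mul_one,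
    Matrix.smul_empty, EmbeddingLike.apply_eq_iff_eq, Matrix.vecCons_inj, Fin.forall_fin_two,
    standardR, and_true, and_false, zero_ne_one, one_ne_zero, if_true, if_false]
  tauto

end Mq

section StandardRForm

open ConvAlgebra

variable {𝕜 : Type*} [Field 𝕜] {q s : 𝕜ˣ}

namespace GLq

/-- The representation `x ↦ (R (T i j ⊗ x))ⱼᵢ` of `GL_q(2)` given by the standard R-matrix. -/
def standardRep (hs : s ^ 2 = q) : GLq q →ₐ[𝕜] Matrix (Fin 2) (Fin 2) 𝕜 :=
  lift q (isQuantumMatrix_standardL (q : 𝕜) s).lift 1 (fun _ ↦ Commute.one_right _) <| by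
    rw [IsQuantumMatrix.lift_det, qdet_standardL (by rw [← hs, Units.val_pow_eq_pow_val])
      s.ne_zero, mul_one]

variable (hs : s ^ 2 = q)

theorem standardRep_ofMq_T (k l : Fin 2) :
    standardRep hs (ofMq q (Mq.T q k l)) = standardL (q : 𝕜) s k l := by
  rw [standardRep, lift_ofMq, IsQuantumMatrix.lift_T]

theorem rtt_standardRep_iff {B : Type*} [Ring B] [Algebra 𝕜 B] {u : Fin 2 → Fin 2 → B} :
    RTT (fun i j k l ↦ standardRep hs (ofMq q (Mq.T q k l)) j i) u u ↔
      IsQuantumMatrix (q : 𝕜) u := by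
  simp only [standardRep_ofMq_T]
  exact ⟨fun h ↦ RTT.isQuantumMatrix h s.ne_zero, fun h ↦ h.rtt q.ne_zero⟩

theorem isQuantumMatrix_transposedCoeff_standardRep :
    IsQuantumMatrix (q : 𝕜) (transposedCoeff (standardRep hs)) :=
  (rtt_standardRep_iff hs).1 <| .coeff (isComatrix_ofMq_T q) (generatesWithInverses_ofMq_T q) <|
    (rtt_standardRep_iff hs).2 (isQuantumMatrix_ofMq_T q)

theorem qdet_transposedCoeff_standardRep_ofMq_T (i j : Fin 2) :
    qdet (q : 𝕜) (transposedCoeff (standardRep hs)) (ofMq q (Mq.T q i j)) =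
      if i = j then 1 else 0 := by
  have heval : (isComatrix_ofMq_T q).eval 𝕜 (qdet (q : 𝕜) (transposedCoeff (standardRep hs))) =
      qdet (q : 𝕜) fun i j ↦ Matrix.of (standardR (q : 𝕜) s i j) := by
    rw [map_qdet]
    congr with i j k l
    rw [IsComatrix.eval_apply, transposedCoeff_apply, standardRep_ofMq_T]
    rfl
  rw [qdet_of_standardR (by rw [← hs, Units.val_pow_eq_pow_val]) s.ne_zero] at heval
  exact (congrFun₂ heval i j).trans Matrix.one_apply

theorem qdet_transposedCoeff_standardRep_one :
    qdet (q : 𝕜) (transposedCoeff (standardRep hs)) 1 = 1 := by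
  have h := map_qdet (evalGroupLike 𝕜 (.one : IsGroupLikeElem 𝕜 (1 : GLq q))) (q : 𝕜)
    (transposedCoeff (standardRep hs))
  simpa [qdet, evalGroupLike_apply, -LinearMap.convMul_apply] using h

/-- Pairing with the group-like element `det_q` is a character of `GL_q(2)`, so it suffices to
compare it with the counit on the generators. -/
theorem qdet_transposedCoeff_standardRep :
    qdet (q : 𝕜) (transposedCoeff (standardRep hs)) = 1 := by
  have hψ := isQuantumMatrix_transposedCoeff_standardRep hs
  have hdet : IsGroupLikeElem 𝕜 (Mq.det q) := ⟨Mq.counit_det q, Mq.comul_det q⟩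
  have hmul := apply_mul_of_isGroupLikeElem (Mq.isComatrix_T q) (Mq.generatesWithInverses_T q)
    hψ.lift_T hdet
  rw [hψ.lift_det] at hmul
  have hχ : AlgHom.ofLinearMap (qdet (q : 𝕜) (transposedCoeff (standardRep hs))).ofConv
      (qdet_transposedCoeff_standardRep_one hs) hmul = Bialgebra.counitAlgHom 𝕜 (GLq q) := by
    refine (generatesWithInverses_ofMq_T q).algHom_ext ?_
    rintro _ ⟨⟨i, j⟩, rfl⟩
    exact (qdet_transposedCoeff_standardRep_ofMq_T hs i j).trans
      ((isComatrix_ofMq_T q).counit_eq i j).symm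
  ext x
  exact DFunLike.congr_fun hχ x

/-- The curried form `x ↦ R (x ⊗ ·)` of the standard R-form of `GL_q(2)`. -/
def standardPairing : GLq q →ₐ[𝕜] ConvAlgebra 𝕜 (GLq q) 𝕜 :=
  lift q (isQuantumMatrix_transposedCoeff_standardRep hs).lift 1
    (fun _ ↦ Commute.one_right _) <| by
      rw [IsQuantumMatrix.lift_det, qdet_transposedCoeff_standardRep, mul_one]

theorem standardPairing_ofMq_T (i j : Fin 2) :
    standardPairing hs (ofMq q (Mq.T q i j)) = transposedCoeff (standardRep hs) i j := by
  rw [standardPairing, lift_ofMq, IsQuantumMatrix.lift_T]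

/-- The standard R-form of `GL_q(2)`. -/
def standardRForm : ConvUnits 𝕜 (GLq q) :=
  Units.map (curry 𝕜 𝕜 (GLq q) (GLq q)).symm.toMonoidHom
    (isUnit_toConv_algHom (standardPairing hs)).unit

theorem isCoquasitriangular_standardRForm : IsCoquasitriangular (standardRForm hs) :=
  RTT.isCoquasitriangular (isComatrix_ofMq_T q) (generatesWithInverses_ofMq_T q)
    (standardPairing_ofMq_T hs) ((rtt_standardRep_iff hs).2 (isQuantumMatrix_ofMq_T q))
    ((curry 𝕜 𝕜 (GLq q) (GLq q)).apply_symm_apply _)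

theorem standardRForm_ofMq_T (i j k l : Fin 2) :
    (standardRForm hs).val (ofMq q (Mq.T q i j) ⊗ₜ ofMq q (Mq.T q k l)) =
      standardR (q : 𝕜) s i j k l := by
  have h := LinearMap.congr_fun (congrArg ofConv (standardPairing_ofMq_T hs i j))
    (ofMq q (Mq.T q k l))
  rwa [transposedCoeff_apply, standardRep_ofMq_T] at h

end GLq

namespace Mq

variable (hs : s ^ 2 = q)

/-- The standard R-form of `M_q(2)`, restricted from `GL_q(2)`. -/
def standardRForm : ConvUnits 𝕜 (Mq q) :=
  Units.map (precomp 𝕜 (Bialgebra.TensorProduct.map (GLq.ofMqBialgHom q)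
    (GLq.ofMqBialgHom q)).toCoalgHom).toMonoidHom (GLq.standardRForm hs)

theorem isCoquasitriangular_standardRForm : IsCoquasitriangular (standardRForm hs) :=
  RTT.isCoquasitriangular (isComatrix_T q) (generatesWithInverses_T q)
    (r := (GLq.standardRep hs).comp (GLq.ofMq q))
    (ψ := ((precomp 𝕜 (GLq.ofMqBialgHom q).toCoalgHom).comp (GLq.standardPairing hs)).comp
      (GLq.ofMq q))
    (fun i j ↦ congrArg (precomp 𝕜 (GLq.ofMqBialgHom q).toCoalgHom)
      (GLq.standardPairing_ofMq_T hs i j))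
    ((GLq.rtt_standardRep_iff hs).2 (isQuantumMatrix_T q)) rfl

theorem isStandardRForm_standardRForm : IsStandardRForm q s (standardRForm hs) where
  coquasitriangular := isCoquasitriangular_standardRForm hs
  values := hasStandardValues_iff.2 (GLq.standardRForm_ofMq_T hs)

theorem IsStandardRForm.eq {R R' : ConvUnits 𝕜 (Mq q)} (h : IsStandardRForm q s R)
    (h' : IsStandardRForm q s R') : R = R' :=
  h.coquasitriangular.eq_of_comatrix (isComatrix_T q) (generatesWithInverses_T q)
    h'.coquasitriangular fun i j k l ↦ (hasStandardValues_iff.1 h.values i j k l).trans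
      (hasStandardValues_iff.1 h'.values i j k l).symm

end Mq

namespace GLq

theorem isExtendedRForm_standardRForm (hs : s ^ 2 = q) :
    IsExtendedRForm q (Mq.standardRForm hs) (standardRForm hs) where
  coquasitriangular := isCoquasitriangular_standardRForm hs
  extends_form _ _ := rfl

theorem IsExtendedRForm.eq {R : ConvUnits 𝕜 (Mq q)} {S S' : ConvUnits 𝕜 (GLq q)}
    (h : IsExtendedRForm q R S) (h' : IsExtendedRForm q R S') : S = S' :=
  h.coquasitriangular.eq_of_comatrix (isComatrix_ofMq_T q) (generatesWithInverses_ofMq_T q)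
    h'.coquasitriangular fun _ _ _ _ ↦ (h.extends_form _ _).trans (h'.extends_form _ _).symm

end GLq

end StandardRForm

end

theorem mainTheorem11 {𝕜 : Type*} [Field 𝕜] (q s : 𝕜ˣ) (hs : s ^ 2 = q) :
    ∃ R : ConvUnits 𝕜 (Mq q),
      (Mq.IsStandardRForm q s R ∧ ∀ R' : ConvUnits 𝕜 (Mq q), Mq.IsStandardRForm q s R' → R' = R) ∧
      (tensorForm (Mq.der q) (Mq.der q) ≠ 0 ∧
        IsInfinitesimalRForm R (tensorForm (Mq.der q) (Mq.der q)) ∧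
        IsCartier R (tensorForm (Mq.der q) (Mq.der q)) ∧
        ∀ (m n : ℕ), ∀ ξ ∈ Mq.homogeneous q m, ∀ η ∈ Mq.homogeneous q n,
          tensorForm (Mq.der q) (Mq.der q) (ξ ⊗ₜ[𝕜] η) =
            (m : 𝕜) * (n : 𝕜) * counit (R := 𝕜) (ξ * η)) ∧
      ∃ S : ConvUnits 𝕜 (GLq q),
        (GLq.IsExtendedRForm q R S ∧
          ∀ S' : ConvUnits 𝕜 (GLq q), GLq.IsExtendedRForm q R S' → S' = S) ∧
        ∃ D : Polynomial (Mq q) →ₗ[𝕜] 𝕜,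
          (GLq.IsHatDer q D ∧ ∀ D' : Polynomial (Mq q) →ₗ[𝕜] 𝕜, GLq.IsHatDer q D' → D' = D) ∧
          ∃ E : GLq q →ₗ[𝕜] 𝕜,
            E ∘ₗ (GLq.mk q).toLinearMap = D ∧
            IsPointDerivation (Bialgebra.counitAlgHom 𝕜 (GLq q)) E ∧
            tensorForm E E ≠ 0 ∧
            IsInfinitesimalRForm S (tensorForm E E) ∧
            IsCartier S (tensorForm E E) := by
  have hM : IsCartier (Mq.standardRForm hs) (tensorForm (Mq.der q) (Mq.der q)) :=
    (Mq.isCoquasitriangular_standardRForm hs).isCartier_tensorForm (Mq.isPointDerivation_der q)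
      (Mq.isCocentral_der q)
  have hG : IsCartier (GLq.standardRForm hs) (tensorForm (GLq.der q) (GLq.der q)) :=
    (GLq.isCoquasitriangular_standardRForm hs).isCartier_tensorForm (GLq.isPointDerivation_der q)
      (GLq.isCocentral_der q)
  exact ⟨Mq.standardRForm hs,
    ⟨Mq.isStandardRForm_standardRForm hs, fun _ h ↦ h.eq (Mq.isStandardRForm_standardRForm hs)⟩,
    ⟨Mq.tensorForm_der_ne_zero q, hM.infinitesimalRForm, hM,
      fun _ _ _ hξ _ hη ↦ Mq.tensorForm_der_of_mem_homogeneous q hξ hη⟩,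
    GLq.standardRForm hs,
    ⟨GLq.isExtendedRForm_standardRForm hs, fun _ h ↦ h.eq (GLq.isExtendedRForm_standardRForm hs)⟩,
    GLq.der q ∘ₗ (GLq.mk q).toLinearMap,
    ⟨GLq.isHatDer_der_comp_mk q, fun _ h ↦ h.eq (GLq.isHatDer_der_comp_mk q)⟩,
    GLq.der q, rfl, GLq.isPointDerivation_der q, GLq.tensorForm_der_ne_zero q,
    hG.infinitesimalRForm, hG⟩
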